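/- Let $f:\mathbb R^{n_v}\to\mathbb R$, $g:\mathbb R^{n_v}\to\mathbb R^{n_g}$, $h:\mathbb R^{n_v}\to\mathbb R^{n_h}$ be twice continuously differentiable, and consider $\min_v f(v)$ subject to $g(v)=0$, $h(v)\le 0$. For $z=(v,\lambda,\mu)\in\mathbb R^{n_v}\times\mathbb R^{n_g}\times\mathbb R^{n_h}$ let $W(z)\succeq 0$ be a symmetric matrix (an approximation of $\nabla_v^2(f+\lambda^\top g+\mu^\top h)(v)$), and let $q(z)\in\mathbb R^{n_v}$, $G(v)\in\mathbb R^{n_v\times n_g}$, $H(v)\in\mathbb R^{n_v\times n_h}$ be (approximations of) $\nabla f(v)$, $\nabla g(v)$, $\nabla h(v)$. The SQP-type iteration maps $z_k=(v_k,\lambda_k,\mu_k)$ to a $z_{k+1}=(v_{k+1},\lambda_{k+1},\mu_{k+1})$ satisfying, with $\Delta v=v_{k+1}-v_k$, $$W(z_k)\Delta v+q(z_k)+G(v_k)\lambda_{k+1}+H(v_k)\mu_{k+1}=0,\quad g(v_k)+G(v_k)^\top\Delta v=0,$$ $$h(v_k)+H(v_k)^\top\Delta v\le 0,\quad \mu_{k+1}\ge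 0,\quad (\mu_{k+1})_i\,(h(v_k)+H(v_k)^\top\Delta v)_i=0\ \ (i=1,\dots,n_h),$$ i.e. the KKT conditions of the QP of minimising $\tfrac12(v-v_k)^\top W(z_k)(v-v_k)+q(z_k)^\top(v-v_k)$ subject to $g(v_k)+G(v_k)^\top(v-v_k)=0$, $h(v_k)+H(v_k)^\top(v-v_k)\le0$. Let $z_\star=(v_\star,\lambda_\star,\mu_\star)$ be a fixed point of this iteration at which the second-order sufficient conditions, LICQ and strict complementarity hold for the QP formed at $z_k=z_\star$. Assume that $W$ is continuous at $z_\star$, $q$ is differentiable at $z_\star$, and $G,H$ are differentiable at $v_\star$. Let $\mathcal A=\{i: h_i(v_\star)=0\}$, $\tilde g=(g,h_{\mathcal A})$, $\tilde G=(G,H_{\mathcal A})$, $\tilde\lambda=(\lambda,\mu_{\mathcal A})$, and $$\Lambda_\star=\frac{\partial q}{\partial v}(z_\star)+\frac{\partial}{\partial v}\big(\tilde G(v)\tilde\lambda_\star\big)(v_\star),\quad W_\star=W(z_\star),\quad E_\star=\Lambda_\star-W_\star,$$ $$C_\star=\nabla\tilde g(v_\star)^\top-\tilde G(v_\star)^\top,\quad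 D_\star=\frac{\partial q}{\partial\tilde\lambda}(z_\star).$$ Assume $C_\star=0$, $D_\star=0$ and that $E_\star$ is symmetric. Let the columns of $Z$ be a basis of the nullspace of $\tilde G(v_\star)^\top$, and put $\hat W_\star=Z^\top W_\star Z$, $\hat E_\star=Z^\top E_\star Z$, $\hat\Lambda_\star=Z^\top\Lambda_\star Z$. Let $$A_\star=\begin{bmatrix}W_\star&\tilde G(v_\star)\\ \tilde G(v_\star)^\top&0\end{bmatrix}^{-1}\begin{bmatrix}E_\star&D_\star\\ C_\star&0\end{bmatrix}$$ be the iteration matrix. Terminology. For $c\ge0$ say that the iteration has Q-factor $c$ at $z_\star$ if there is a norm $N$ on $\mathbb R^{n_v+n_g+n_h}$ such that for every $c'>c$ there is a neighbourhood of $z_\star$ in which every step $z\mapsto z^+$ satisfies $N(z^+-z_\star)\le c'N(z-z_\star)$. The asymptotic contraction rate is $\kappa$ if near $z_\star$ every $z$ has exactly one successor, $\kappa=\rho(A_\star)$ (spectral radius), and $\kappa$ is the infimum of all Q-factors. The iteration converges locally if for every neighbourhood $V$ of $z_\star$ there is a neighbourhood $U$ such that from each $z_0\in U$ there is an infinite sequence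 of iterates, and every such sequence stays in $V$ and converges to $z_\star$. It converges Q-linearly with rate (at most) $\kappa$ if it converges locally and has Q-factor $c$ for every $c>0$ with $c\ge\kappa$. Then: 1. There is a smallest $\kappa\ge0$ with $-\kappa\hat W_\star\preceq\hat E_\star\preceq\kappa\hat W_\star$, and it is the asymptotic contraction rate. 2. If $\frac1{1+\kappa}\hat\Lambda_\star\preceq\hat W_\star\preceq\frac1{1-\kappa}\hat\Lambda_\star$ for some $\kappa\in[0,1)$, then the iteration converges Q-linearly with rate at most $\kappa$; if $\kappa$ is the smallest such number in $[0,1)$, then the asymptotic contraction rate is exactly $\kappa$. 3. If the iteration converges locally, then $\hat W_\star\succeq\frac12\hat\Lambda_\star$. 4. If $\hat\Lambda_\star\succ0$ and $\hat W_\star\succ\frac12\hat\Lambda_\star$, then the iteration converges Q-linearly with some rate $\kappa<1$. -/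

import Mathlib

open Filter Topology Matrix

noncomputable section

/-- Primal-dual variables `z = (v, lam, mu)`. -/
abbrev PrimalDual (nv ng nh : ℕ) : Type :=
  (Fin nv → ℝ) × (Fin ng → ℝ) × (Fin nh → ℝ)

/-- The problem `min f(v)` subject to `g(v) = 0`, `h(v) ≤ 0`, together with the approximations that
define an (inexact) SQP-type method for it: `W(z)` for the Hessian of the Lagrangian, `q(z)` for
`∇f(v)`, and `G(v)`, `H(v)` for `∇g(v)`, `∇h(v)` (gradients are columns). -/
structure SQPMethod (nv ng nh : ℕ) where
  f : (Fin nv → ℝ) → ℝ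
  g : (Fin nv → ℝ) → (Fin ng → ℝ)
  h : (Fin nv → ℝ) → (Fin nh → ℝ)
  contDiff_f : ContDiff ℝ 2 f
  contDiff_g : ContDiff ℝ 2 g
  contDiff_h : ContDiff ℝ 2 h
  W : PrimalDual nv ng nh → Matrix (Fin nv) (Fin nv) ℝ
  q : PrimalDual nv ng nh → (Fin nv → ℝ)
  G : (Fin nv → ℝ) → Matrix (Fin nv) (Fin ng) ℝ
  H : (Fin nv → ℝ) → Matrix (Fin nv) (Fin nh) ℝ
  posSemidef_W : ∀ z, (W z).PosSemidef

namespace SQPMethod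

variable {nv ng nh : ℕ} (S : SQPMethod nv ng nh)

/-- `z'` is a successor of `z` under the SQP-type iteration: it satisfies the KKT conditions of the
QP subproblem formed at `z`, which minimises
`½ (v' - v)ᵀ W(z) (v' - v) + q(z)ᵀ (v' - v)` over `v'` subject to
`g(v) + G(v)ᵀ (v' - v) = 0` and `h(v) + H(v)ᵀ (v' - v) ≤ 0`. -/
def IsStep (z z' : PrimalDual nv ng nh) : Prop :=
  S.W z *ᵥ (z'.1 - z.1) + S.q z + S.G z.1 *ᵥ z'.2.1 + S.H z.1 *ᵥ z'.2.2 = 0 ∧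
  S.g z.1 + (S.G z.1)ᵀ *ᵥ (z'.1 - z.1) = 0 ∧
  S.h z.1 + (S.H z.1)ᵀ *ᵥ (z'.1 - z.1) ≤ 0 ∧
  0 ≤ z'.2.2 ∧
  ∀ i, z'.2.2 i * (S.h z.1 + (S.H z.1)ᵀ *ᵥ (z'.1 - z.1)) i = 0

/-- An infinite sequence of iterates. -/
def IsIterates (z : ℕ → PrimalDual nv ng nh) : Prop :=
  ∀ k, S.IsStep (z k) (z (k + 1))

/-- Indices of the equality constraints and of the inequality constraints active at `v`. At a fixed
point with primal part `v` these are the active constraints of the QP subproblem. -/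
abbrev ActiveIdx (v : Fin nv → ℝ) : Type :=
  Fin ng ⊕ {i : Fin nh // S.h v i = 0}

/-- `g̃ = (g, h_A)` with `A` the active set at `vs`. -/
def gTilde (vs v : Fin nv → ℝ) : S.ActiveIdx vs → ℝ :=
  Sum.elim (S.g v) (fun i => S.h v i.1)

/-- `G̃ = (G, H_A)` with `A` the active set at `vs`. -/
def GTilde (vs v : Fin nv → ℝ) : Matrix (Fin nv) (S.ActiveIdx vs) ℝ :=
  Matrix.of fun j => Sum.elim (S.G v j) (fun i => S.H v j i.1)

/-- `λ̃ = (lam, mu_A)`, the multipliers of the active constraints. -/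
def multTilde (zs : PrimalDual nv ng nh) : S.ActiveIdx zs.1 → ℝ :=
  Sum.elim zs.2.1 (fun i => zs.2.2 i.1)

/-- The point `zs` with its multipliers of active constraints replaced by `l`. -/
def withMultTilde (zs : PrimalDual nv ng nh) (l : S.ActiveIdx zs.1 → ℝ) : PrimalDual nv ng nh :=
  (zs.1, fun j => l (Sum.inl j),
    fun i => if hi : S.h zs.1 i = 0 then l (Sum.inr ⟨i, hi⟩) else zs.2.2 i)

/-- Linear independence constraint qualification at `zs` for the QP subproblem formed at `zs`. -/
def LICQ (zs : PrimalDual nv ng nh) : Prop :=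
  LinearIndependent ℝ (S.GTilde zs.1 zs.1).col

/-- Strict complementarity at `zs` for the QP subproblem formed at `zs`. -/
def StrictComplementarity (zs : PrimalDual nv ng nh) : Prop :=
  ∀ i, S.h zs.1 i = 0 → 0 < zs.2.2 i

/-- The critical cone at `zs` of the QP subproblem formed at `zs`. -/
def criticalCone (zs : PrimalDual nv ng nh) : Set (Fin nv → ℝ) :=
  {w | (S.G zs.1)ᵀ *ᵥ w = 0 ∧
    ∀ i, S.h zs.1 i = 0 →
      ((S.H zs.1)ᵀ *ᵥ w) i ≤ 0 ∧ (0 < zs.2.2 i → ((S.H zs.1)ᵀ *ᵥ w) i = 0)}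

/-- Second-order sufficient conditions at `zs` for the QP subproblem formed at `zs`: the KKT
conditions hold, and the Hessian `W(zs)` of its Lagrangian is positive on the nonzero vectors of the
critical cone. -/
def SOSC (zs : PrimalDual nv ng nh) : Prop :=
  S.IsStep zs zs ∧ ∀ w ∈ S.criticalCone zs, w ≠ 0 → 0 < w ⬝ᵥ (S.W zs *ᵥ w)

/-- `Λ_* = ∂q/∂v (z_*) + ∂(G̃(v) λ̃_*)/∂v (v_*)`. -/
def Lam (zs : PrimalDual nv ng nh) : Matrix (Fin nv) (Fin nv) ℝ :=
  LinearMap.toMatrix' (fderiv ℝ (fun v => S.q (v, zs.2)) zs.1 : (Fin nv → ℝ) →ₗ[ℝ] (Fin nv → ℝ)) +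
  LinearMap.toMatrix' (fderiv ℝ (fun v => S.GTilde zs.1 v *ᵥ S.multTilde zs) zs.1 :
    (Fin nv → ℝ) →ₗ[ℝ] (Fin nv → ℝ))

/-- `E_* = Λ_* - W_*`. -/
def E (zs : PrimalDual nv ng nh) : Matrix (Fin nv) (Fin nv) ℝ :=
  S.Lam zs - S.W zs

/-- `C_* = ∇g̃(v_*)ᵀ - G̃(v_*)ᵀ`. -/
def C (zs : PrimalDual nv ng nh) : Matrix (S.ActiveIdx zs.1) (Fin nv) ℝ :=
  LinearMap.toMatrix' (fderiv ℝ (S.gTilde zs.1) zs.1 :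
    (Fin nv → ℝ) →ₗ[ℝ] (S.ActiveIdx zs.1 → ℝ)) - (S.GTilde zs.1 zs.1)ᵀ

/-- `D_* = ∂q/∂λ̃ (z_*)`. -/
def D (zs : PrimalDual nv ng nh) : Matrix (Fin nv) (S.ActiveIdx zs.1) ℝ :=
  LinearMap.toMatrix' (fderiv ℝ (fun l => S.q (S.withMultTilde zs l)) (S.multTilde zs) :
    (S.ActiveIdx zs.1 → ℝ) →ₗ[ℝ] (Fin nv → ℝ))

/-- `K_* = [[W_*, G̃_*], [G̃_*ᵀ, 0]]`. -/
def K (zs : PrimalDual nv ng nh) :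
    Matrix (Fin nv ⊕ S.ActiveIdx zs.1) (Fin nv ⊕ S.ActiveIdx zs.1) ℝ :=
  Matrix.fromBlocks (S.W zs) (S.GTilde zs.1 zs.1) (S.GTilde zs.1 zs.1)ᵀ 0

/-- `L_* = [[E_*, D_*], [C_*, 0]]`. -/
def L (zs : PrimalDual nv ng nh) :
    Matrix (Fin nv ⊕ S.ActiveIdx zs.1) (Fin nv ⊕ S.ActiveIdx zs.1) ℝ :=
  Matrix.fromBlocks (S.E zs) (S.D zs) (S.C zs) 0

/-- The iteration matrix `A_* = K_*⁻¹ L_*`. -/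
def iterationMatrix (zs : PrimalDual nv ng nh) :
    Matrix (Fin nv ⊕ S.ActiveIdx zs.1) (Fin nv ⊕ S.ActiveIdx zs.1) ℝ :=
  (S.K zs)⁻¹ * S.L zs

/-- The columns of `Z` are a basis of the nullspace of `G̃(v_*)ᵀ`. -/
def IsNullspaceBasis (zs : PrimalDual nv ng nh) {nz : ℕ} (Z : Matrix (Fin nv) (Fin nz) ℝ) : Prop :=
  LinearIndependent ℝ Z.col ∧
  Submodule.span ℝ (Set.range Z.col) = LinearMap.ker (S.GTilde zs.1 zs.1)ᵀ.mulVecLin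

/-- Local convergence to `zs`: from every starting point close enough to `zs` the iteration can be
carried out, and its iterates stay in any prescribed neighbourhood of `zs` and converge to `zs`. -/
def ConvergesLocally (zs : PrimalDual nv ng nh) : Prop :=
  ∀ V ∈ 𝓝 zs, ∃ U ∈ 𝓝 zs, ∀ z₀ ∈ U,
    (∃ z, S.IsIterates z ∧ z 0 = z₀) ∧
    ∀ z, S.IsIterates z → z 0 = z₀ → (∀ k, z k ∈ V) ∧ Tendsto z atTop (𝓝 zs)

/-- In some norm `N` on the primal-dual space,
`limsup N (z' - zs) / N (z - zs) ≤ c` over the steps `z ↦ z'` with `z → zs`. -/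
def HasQFactor (zs : PrimalDual nv ng nh) (c : ℝ) : Prop :=
  ∃ N : Seminorm ℝ (PrimalDual nv ng nh), (∀ x, N x = 0 → x = 0) ∧
    ∀ c', c < c' → ∀ᶠ z in 𝓝 zs, ∀ z', S.IsStep z z' → N (z' - zs) ≤ c' * N (z - zs)

/-- `κ` is the asymptotic contraction rate of the iteration at `zs`: near `zs` each point has exactly
one successor, `κ` is the spectral radius of the iteration matrix, and `κ` is the best asymptotic
contraction factor that can be had in a norm. -/
def HasAsymptoticRate (zs : PrimalDual nv ng nh) (κ : ℝ) : Prop :=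
  (∀ᶠ z in 𝓝 zs, ∃! z', S.IsStep z z') ∧
  spectralRadius ℂ ((S.iterationMatrix zs).map (algebraMap ℝ ℂ)) = ENNReal.ofReal κ ∧
  IsGLB {c : ℝ | 0 ≤ c ∧ S.HasQFactor zs c} κ

/-- Local Q-linear convergence with asymptotic rate at most `κ`. If `κ > 0`, one norm realises the
factor `κ`; if `κ = 0`, every positive factor is realised by some norm. -/
def ConvergesQLinearly (zs : PrimalDual nv ng nh) (κ : ℝ) : Prop :=
  S.ConvergesLocally zs ∧ ∀ c, 0 < c → κ ≤ c → S.HasQFactor zs c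

end SQPMethod

/-- `Zᵀ M Z`. -/
def reduced {n m : ℕ} (Z : Matrix (Fin n) (Fin m) ℝ) (M : Matrix (Fin n) (Fin n) ℝ) :
    Matrix (Fin m) (Fin m) ℝ :=
  Zᵀ * M * Z

/-- The Loewner order on real matrices: `B - A` is symmetric positive semidefinite. -/
def LoewnerLE {m : ℕ} (A B : Matrix (Fin m) (Fin m) ℝ) : Prop :=
  (B - A).PosSemidef

/-- The strict Loewner order on real matrices: `B - A` is symmetric positive definite. -/
def LoewnerLT {m : ℕ} (A B : Matrix (Fin m) (Fin m) ℝ) : Prop :=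
  (B - A).PosDef

end

/-! Near the fixed point the KKT conditions reduce to one linear system. LICQ and SOSC make its
matrix invertible, strict complementarity freezes the active set, and convexity (`W` is positive
semidefinite) excludes any other KKT point, even a distant one. So the iteration is locally a
single-valued map, `stepMap`. Its linear system has a right-hand side vanishing at the fixed point,
so continuity of the matrix suffices for differentiability there (`HasFDerivAt.mulVec_of_eq_zero`).

A basis `Y` of the nullspace that is orthonormal for `W_*` and diagonalises `E_*` with diagonal `d`
makes everything scalar. The upper left block of `K_*⁻¹` is `Y Yᵀ`, so the derivative `M` of the
step map acts on the reduced gradient perturbation `l` by `l ∘ M = -(d * l)`. The square `M²`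
depends on its argument only through `l`. Two steps are needed because `q` may depend on inactive
multipliers, about which `D_* = 0` says nothing; after one application of `M` these components
vanish.

Hence every `κ > 0` with `κ ≥ ‖d‖` is attained as a contraction factor of `M` in a suitable norm
(`exists_seminorm_map_le`). Each nonzero `-d i` is an eigenvalue of `M`, so no smaller Q-factor is
possible. An entry with `|d i| > 1` rules out local convergence by an invariant cone argument
(`not_locallyConverges_of_cone`). The spectral radius of `A_*` is also `‖d‖`. In these coordinates
the reduced `W_*`, `E_*`, `Λ_*` become `1`, `d`, `d + 1`, and each matrix inequality becomes a bound
on the entries of `d`. -/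

/-! ### Linear algebra: simultaneous diagonalisation, Loewner order, spectral radius -/

theorem exists_transpose_mul_mul_eq_diagonal {m : ℕ} {A : Matrix (Fin m) (Fin m) ℝ}
    (hA : A.IsSymm) :
    ∃ (U : Matrix (Fin m) (Fin m) ℝ) (d : Fin m → ℝ),
      IsUnit U ∧ Uᵀ * U = 1 ∧ Uᵀ * A * U = diagonal d := by
  have hA' : A.IsHermitian := by
    rw [IsHermitian, conjTranspose_eq_transpose_of_trivial]; exact hA
  have h := hA'.conjStarAlgAut_star_eigenvectorUnitary
  rw [Unitary.conjStarAlgAut_star_apply] at h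
  refine ⟨hA'.eigenvectorUnitary, hA'.eigenvalues, ?_, ?_, ?_⟩
  · exact (Unitary.toUnits hA'.eigenvectorUnitary).isUnit
  · have := Unitary.coe_star_mul_self hA'.eigenvectorUnitary
    rwa [star_eq_conjTranspose, conjTranspose_eq_transpose_of_trivial] at this
  · rw [star_eq_conjTranspose, conjTranspose_eq_transpose_of_trivial] at h
    exact h

/-- Simultaneous diagonalisation by congruence of a positive definite and a symmetric matrix. -/
theorem exists_simultaneous_diagonalization {m : ℕ} {A B : Matrix (Fin m) (Fin m) ℝ}
    (hA : A.PosDef) (hB : B.IsSymm) :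
    ∃ (T : Matrix (Fin m) (Fin m) ℝ) (d : Fin m → ℝ),
      IsUnit T ∧ Tᵀ * A * T = 1 ∧ Tᵀ * B * T = diagonal d := by
  have hAs : A.IsSymm := by
    have := hA.1; rwa [IsHermitian, conjTranspose_eq_transpose_of_trivial] at this
  obtain ⟨U, a, hU, -, hUA⟩ := exists_transpose_mul_mul_eq_diagonal hAs
  have ha : ∀ i, 0 < a i := by
    have h := (Matrix.IsUnit.posDef_star_left_conjugate_iff (x := A) hU).2 hA
    rw [star_eq_conjTranspose, conjTranspose_eq_transpose_of_trivial, hUA] at h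
    exact posDef_diagonal_iff.1 h
  set R : Matrix (Fin m) (Fin m) ℝ := diagonal fun i => (√(a i))⁻¹ with hR
  have hRt : Rᵀ = R := diagonal_transpose _
  have hRu : IsUnit R := by
    rw [hR, isUnit_iff_isUnit_det, det_diagonal, isUnit_iff_ne_zero]
    exact Finset.prod_ne_zero_iff.2 fun i _ => inv_ne_zero (Real.sqrt_ne_zero'.2 (ha i))
  have h1 : (U * R)ᵀ * A * (U * R) = 1 := by
    calc (U * R)ᵀ * A * (U * R) = R * (Uᵀ * A * U) * R := by
          rw [transpose_mul, hRt]; simp only [Matrix.mul_assoc]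
      _ = 1 := by
          rw [hUA, hR, diagonal_mul_diagonal, diagonal_mul_diagonal, ← diagonal_one]
          congr 1; ext i
          have h0 := Real.sqrt_ne_zero'.2 (ha i)
          have := Real.mul_self_sqrt (ha i).le
          field_simp
          nlinarith
  have hs : ((U * R)ᵀ * B * (U * R)).IsSymm := by
    rw [IsSymm, transpose_mul, transpose_mul _ B, transpose_transpose, hB.eq, transpose_mul]
    simp only [Matrix.mul_assoc]
  -- `U * R` already turns `A` into the identity, which the orthogonal congruence by `V` preserves.
  obtain ⟨V, d, hV, hVV, hVB⟩ := exists_transpose_mul_mul_eq_diagonal hs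
  refine ⟨U * R * V, d, (hU.mul hRu).mul hV, ?_, ?_⟩
  · calc (U * R * V)ᵀ * A * (U * R * V) = Vᵀ * ((U * R)ᵀ * A * (U * R)) * V := by
          rw [transpose_mul (U * R)]; simp only [Matrix.mul_assoc]
      _ = 1 := by rw [h1, Matrix.mul_one, hVV]
  · rw [← hVB, transpose_mul (U * R)]; simp only [Matrix.mul_assoc]

theorem loewnerLE_congr_iff {m : ℕ} {T : Matrix (Fin m) (Fin m) ℝ} (hT : IsUnit T)
    (A B : Matrix (Fin m) (Fin m) ℝ) :
    LoewnerLE A B ↔ LoewnerLE (Tᵀ * A * T) (Tᵀ * B * T) := by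
  rw [LoewnerLE, LoewnerLE, ← Matrix.IsUnit.posSemidef_star_left_conjugate_iff (x := B - A) hT,
    star_eq_conjTranspose, conjTranspose_eq_transpose_of_trivial, Matrix.mul_sub, Matrix.sub_mul]

theorem loewnerLT_congr_iff {m : ℕ} {T : Matrix (Fin m) (Fin m) ℝ} (hT : IsUnit T)
    (A B : Matrix (Fin m) (Fin m) ℝ) :
    LoewnerLT A B ↔ LoewnerLT (Tᵀ * A * T) (Tᵀ * B * T) := by
  rw [LoewnerLT, LoewnerLT, ← Matrix.IsUnit.posDef_star_left_conjugate_iff (x := B - A) hT,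
    star_eq_conjTranspose, conjTranspose_eq_transpose_of_trivial, Matrix.mul_sub, Matrix.sub_mul]

theorem loewnerLE_diagonal_iff {m : ℕ} (a b : Fin m → ℝ) :
    LoewnerLE (diagonal a) (diagonal b) ↔ ∀ i, a i ≤ b i := by
  rw [LoewnerLE, diagonal_sub, posSemidef_diagonal_iff]
  simp

theorem loewnerLT_diagonal_iff {m : ℕ} (a b : Fin m → ℝ) :
    LoewnerLT (diagonal a) (diagonal b) ↔ ∀ i, a i < b i := by
  rw [LoewnerLT, diagonal_sub, posDef_diagonal_iff]
  simp

/-- The complex spectrum of `B * C` agrees, away from `0`, with the diagonal of `C * B` if the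
latter is diagonal. -/
theorem mem_spectrum_mul_iff {ι κ : Type*} [Fintype ι] [DecidableEq ι] [Fintype κ]
    [DecidableEq κ] (B : Matrix ι κ ℝ) (C : Matrix κ ι ℝ) {m : ℕ} (P : Matrix κ (Fin m) ℝ)
    (Q : Matrix (Fin m) κ ℝ) (hCB : C * B = P * Q) (d : Fin m → ℝ)
    (hd : Q * P = diagonal d) {μ : ℂ} (hμ : μ ≠ 0) :
    μ ∈ spectrum ℂ ((B * C).map (algebraMap ℝ ℂ)) ↔ ∃ i, μ = d i := by
  -- Swapping factors changes a characteristic polynomial only by powers of `X`. Two swaps, `B * C`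
  -- to `C * B = P * Q` to `Q * P`, end at the diagonal matrix.
  have h1 := charpoly_mul_comm' B C
  have h2 := charpoly_mul_comm' P Q
  rw [hd, charpoly_diagonal, ← hCB] at h2
  have e1 := congrArg (Polynomial.eval₂ (algebraMap ℝ ℂ) μ) h1
  have e2 := congrArg (Polynomial.eval₂ (algebraMap ℝ ℂ) μ) h2
  simp only [Polynomial.eval₂_mul, Polynomial.eval₂_pow, Polynomial.eval₂_X,
    Polynomial.eval₂_finsetProd, Polynomial.eval₂_sub, Polynomial.eval₂_C] at e1 e2
  rw [mem_spectrum_iff_isRoot_charpoly, charpoly_map, Polynomial.IsRoot.def, Polynomial.eval_map]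
  have hp : ∀ n : ℕ, μ ^ n ≠ 0 := fun n => pow_ne_zero n hμ
  have : (B * C).charpoly.eval₂ (algebraMap ℝ ℂ) μ = 0 ↔
      ∏ i, (μ - algebraMap ℝ ℂ (d i)) = 0 := by
    constructor
    · intro h
      rw [h, mul_zero, eq_comm, mul_eq_zero, or_iff_right (hp _)] at e1
      rw [e1, mul_zero, eq_comm, mul_eq_zero, or_iff_right (hp _)] at e2
      exact e2
    · intro h
      rw [h, mul_zero, mul_eq_zero, or_iff_right (hp _)] at e2
      rw [e2, mul_zero, mul_eq_zero, or_iff_right (hp _)] at e1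
      exact e1
  rw [this, Finset.prod_eq_zero_iff]
  simp [sub_eq_zero]

theorem spectralRadius_mul_eq {ι κ : Type*} [Fintype ι] [DecidableEq ι] [Fintype κ]
    [DecidableEq κ] (B : Matrix ι κ ℝ) (C : Matrix κ ι ℝ) {m : ℕ} (P : Matrix κ (Fin m) ℝ)
    (Q : Matrix (Fin m) κ ℝ) (hCB : C * B = P * Q) (d : Fin m → ℝ)
    (hd : Q * P = diagonal d) :
    spectralRadius ℂ ((B * C).map (algebraMap ℝ ℂ)) = ENNReal.ofReal ‖d‖ := by
  apply le_antisymm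
  · refine iSup₂_le fun μ hμ => ?_
    by_cases h0 : μ = 0
    · simp [h0]
    · obtain ⟨i, rfl⟩ := (mem_spectrum_mul_iff B C P Q hCB d hd h0).1 hμ
      rw [← enorm_eq_nnnorm, ← ofReal_norm, Complex.norm_real]
      exact ENNReal.ofReal_le_ofReal (norm_le_pi_norm d i)
  · by_cases h0 : d = 0
    · simp [h0]
    · obtain ⟨i, hi⟩ : ∃ i, ‖d‖ = ‖d i‖ := by
        have : Nonempty (Fin m) := by
          by_contra h
          rw [not_nonempty_iff] at h
          exact h0 (Subsingleton.elim _ _)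
        obtain ⟨i, hi⟩ := Finite.exists_max fun i => ‖d i‖
        exact ⟨i, le_antisymm ((pi_norm_le_iff_of_nonneg (norm_nonneg _)).2 hi)
          (norm_le_pi_norm d i)⟩
      have hdi : ((d i : ℝ) : ℂ) ≠ 0 := by
        intro h
        rw [Complex.ofReal_eq_zero] at h
        rw [h, norm_zero, norm_eq_zero] at hi
        exact h0 hi
      have := (mem_spectrum_mul_iff B C P Q hCB d hd hdi).2 ⟨i, rfl⟩
      refine le_trans ?_ (le_iSup₂ (f := fun k _ => (‖k‖₊ : ENNReal)) _ this)
      rw [← enorm_eq_nnnorm, ← ofReal_norm, Complex.norm_real, hi]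

/-! ### Local dynamics of a map differentiable at a fixed point -/

section LocalDynamics

variable {X : Type*} [NormedAddCommGroup X] [NormedSpace ℝ X]

theorem Seminorm.continuous_of_finiteDimensional [FiniteDimensional ℝ X] (N : Seminorm ℝ X) :
    Continuous N := by
  rw [← continuousOn_univ]
  exact N.convexOn.continuousOn isOpen_univ

theorem Seminorm.exists_le_mul_norm [FiniteDimensional ℝ X] (N : Seminorm ℝ X) :
    ∃ C : ℝ, 0 < C ∧ ∀ x, N x ≤ C * ‖x‖ :=
  N.bound_of_continuous_normedSpace N.continuous_of_finiteDimensional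

theorem Seminorm.exists_mul_norm_le [FiniteDimensional ℝ X] (N : Seminorm ℝ X)
    (hN : ∀ x, N x = 0 → x = 0) : ∃ m : ℝ, 0 < m ∧ ∀ x, m * ‖x‖ ≤ N x := by
  by_cases hX : Subsingleton X
  · exact ⟨1, one_pos, fun x => by rw [Subsingleton.elim x 0]; simp⟩
  rw [not_subsingleton_iff_nontrivial] at hX
  have : ProperSpace X := FiniteDimensional.proper ℝ X
  obtain ⟨y, hy, hmin⟩ := (isCompact_sphere (0 : X) 1).exists_isMinOn
    (NormedSpace.sphere_nonempty.2 zero_le_one)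
    N.continuous_of_finiteDimensional.continuousOn
  have hy1 : ‖y‖ = 1 := by simpa using hy
  have hy0 : 0 < N y := lt_of_le_of_ne (apply_nonneg N y) fun h => by
    rw [hN y h.symm, norm_zero] at hy1; exact zero_ne_one hy1
  refine ⟨N y, hy0, fun x => ?_⟩
  by_cases hx : x = 0
  · simp [hx]
  have hx' : 0 < ‖x‖ := norm_pos_iff.2 hx
  have h := isMinOn_iff.1 hmin (‖x‖⁻¹ • x) (by simp [norm_smul, hx])
  rw [map_smul_eq_mul, norm_inv, norm_norm] at h
  rw [inv_mul_eq_div, le_div_iff₀ hx'] at h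
  exact h

variable [FiniteDimensional ℝ X] {F : X → X} {M : X →L[ℝ] X} {x₀ : X}

theorem HasFDerivAt.eventually_seminorm_sub_le (hF : HasFDerivAt F M x₀) (hx₀ : F x₀ = x₀)
    (N : Seminorm ℝ X) (hN : ∀ x, N x = 0 → x = 0) {δ : ℝ} (hδ : 0 < δ) :
    ∀ᶠ z in 𝓝 x₀, N (F z - x₀ - M (z - x₀)) ≤ δ * N (z - x₀) := by
  obtain ⟨C, hC, hNC⟩ := N.exists_le_mul_norm
  obtain ⟨m, hm, hNm⟩ := N.exists_mul_norm_le hN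
  filter_upwards [hF.isLittleO.def (show 0 < δ * m / C by positivity)] with z hz
  rw [hx₀] at hz
  calc N (F z - x₀ - M (z - x₀)) ≤ C * ‖F z - x₀ - M (z - x₀)‖ := hNC _
    _ ≤ C * (δ * m / C * ‖z - x₀‖) := by gcongr
    _ = δ * (m * ‖z - x₀‖) := by field_simp
    _ ≤ δ * N (z - x₀) := by gcongr; exact hNm _

theorem HasFDerivAt.eventually_seminorm_le (hF : HasFDerivAt F M x₀) (hx₀ : F x₀ = x₀)
    (N : Seminorm ℝ X) (hN : ∀ x, N x = 0 → x = 0) {c : ℝ} (hM : ∀ x, N (M x) ≤ c * N x)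
    {c' : ℝ} (hc : c < c') :
    ∀ᶠ z in 𝓝 x₀, N (F z - x₀) ≤ c' * N (z - x₀) := by
  filter_upwards [hF.eventually_seminorm_sub_le hx₀ N hN (sub_pos.2 hc)] with z hz
  have h1 := map_add_le_add N (F z - x₀ - M (z - x₀)) (M (z - x₀))
  rw [sub_add_cancel] at h1
  linarith [hM (z - x₀)]

/-- Along `x₀ + t • x` with `t → 0⁺` the map multiplies the displacement by `a` up to `o(t)`, so a
Q-factor in any norm is at least `|a|`. -/
theorem HasFDerivAt.abs_eigenvalue_le (hF : HasFDerivAt F M x₀) (hx₀ : F x₀ = x₀)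
    (N : Seminorm ℝ X) (hN : ∀ x, N x = 0 → x = 0) {c : ℝ}
    (h : ∀ c', c < c' → ∀ᶠ z in 𝓝 x₀, N (F z - x₀) ≤ c' * N (z - x₀))
    {a : ℝ} {x : X} (hx : x ≠ 0) (hMx : M x = a • x) : |a| ≤ c := by
  refine le_of_forall_pos_le_add fun ε hε => ?_
  have hev := (h (c + ε / 2) (by linarith)).and
    (hF.eventually_seminorm_sub_le hx₀ N hN (half_pos hε))
  have ht : Tendsto (fun t : ℝ => x₀ + t • x) (𝓝[>] 0) (𝓝 x₀) := by
    have : Continuous fun t : ℝ => x₀ + t • x := by fun_prop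
    have := this.tendsto 0
    rw [zero_smul, add_zero] at this
    exact this.mono_left nhdsWithin_le_nhds
  obtain ⟨t, ⟨h1, h2⟩, ht0⟩ := ((ht.eventually hev).and self_mem_nhdsWithin).exists
  rw [add_sub_cancel_left] at h1 h2
  have hNx : 0 < N (t • x) := lt_of_le_of_ne (apply_nonneg N _) fun h => by
    have := hN _ h.symm
    rw [smul_eq_zero] at this
    exact this.elim (ne_of_gt ht0) hx
  have hM : N (M (t • x)) = |a| * N (t • x) := by
    rw [map_smul, hMx, smul_comm, map_smul_eq_mul N a, Real.norm_eq_abs]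
  have h3 : N (M (t • x)) ≤ N (F (x₀ + t • x) - x₀)
      + N (F (x₀ + t • x) - x₀ - M (t • x)) := by
    have := map_sub_le_add N (F (x₀ + t • x) - x₀) (F (x₀ + t • x) - x₀ - M (t • x))
    rwa [sub_sub_cancel] at this
  rw [hM] at h3
  have : |a| * N (t • x) ≤ (c + ε) * N (t • x) := by linarith
  exact le_of_mul_le_mul_right this hNx

/-- Local convergence of the iterations `z (k + 1) ∈ R (z k)` to `x₀`. -/
def LocallyConverges (R : X → X → Prop) (x₀ : X) : Prop :=
  ∀ V ∈ 𝓝 x₀, ∃ U ∈ 𝓝 x₀, ∀ z₀ ∈ U,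
    (∃ z : ℕ → X, (∀ k, R (z k) (z (k + 1))) ∧ z 0 = z₀) ∧
    ∀ z : ℕ → X, (∀ k, R (z k) (z (k + 1))) → z 0 = z₀ →
      (∀ k, z k ∈ V) ∧ Tendsto z atTop (𝓝 x₀)

theorem locallyConverges_of_contraction {R : X → X → Prop}
    (hR : ∀ᶠ z in 𝓝 x₀, ∀ z', R z z' ↔ z' = F z)
    (N : Seminorm ℝ X) (hN : ∀ x, N x = 0 → x = 0) {c : ℝ} (hc0 : 0 ≤ c) (hc : c < 1)
    (hF : ∀ᶠ z in 𝓝 x₀, N (F z - x₀) ≤ c * N (z - x₀)) : LocallyConverges R x₀ := by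
  intro V hV
  obtain ⟨m, hm, hNm⟩ := N.exists_mul_norm_le hN
  obtain ⟨ε, hε, hball⟩ := Metric.eventually_nhds_iff.1 ((hR.and hF).and hV)
  -- The `N`-ball of radius `m * ε` lies in the norm ball of radius `ε` on which all local
  -- hypotheses hold, and it is invariant because `c < 1`.
  have key : ∀ z, N (z - x₀) < m * ε →
      ((∀ z', R z z' ↔ z' = F z) ∧ N (F z - x₀) ≤ c * N (z - x₀)) ∧ z ∈ V := by
    intro z hz
    refine hball ?_
    rw [dist_eq_norm]
    exact lt_of_mul_lt_mul_left ((hNm _).trans_lt hz) hm.le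
  refine ⟨{z | N (z - x₀) < m * ε}, ?_, fun z₀ hz₀ => ?_⟩
  · have hcont : Continuous fun z => N (z - x₀) :=
      N.continuous_of_finiteDimensional.comp (continuous_id.sub continuous_const)
    refine (isOpen_lt hcont continuous_const).mem_nhds ?_
    simp only [Set.mem_ofPred_eq, sub_self, map_zero]
    positivity
  have hz₀' : N (z₀ - x₀) < m * ε := hz₀
  have bound : ∀ z : ℕ → X, z 0 = z₀ →
      (∀ k, N (z k - x₀) < m * ε → z (k + 1) = F (z k)) →
      ∀ k, N (z k - x₀) ≤ c ^ k * N (z₀ - x₀) ∧ N (z k - x₀) < m * ε := by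
    intro z h0 hz k
    induction k with
    | zero => rw [h0]; simpa using hz₀'
    | succ k ih =>
      have h1 := (key _ ih.2).1.2
      have hnn : 0 ≤ N (z k - x₀) := apply_nonneg N _
      rw [hz k ih.2]
      constructor
      · rw [pow_succ', mul_assoc]
        exact h1.trans (mul_le_mul_of_nonneg_left ih.1 hc0)
      · nlinarith [ih.2]
  constructor
  · have h := bound (fun k => F^[k] z₀) rfl fun k _ => Function.iterate_succ_apply' F k z₀
    exact ⟨fun k => F^[k] z₀, fun k => ((key _ (h k).2).1.1 _).2
      (Function.iterate_succ_apply' F k z₀), rfl⟩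
  · intro z hz h0
    have h := bound z h0 fun k hk => ((key _ hk).1.1 _).1 (hz k)
    refine ⟨fun k => (key _ (h k).2).2, ?_⟩
    rw [tendsto_iff_norm_sub_tendsto_zero]
    have hlim : Tendsto (fun k => m⁻¹ * (c ^ k * N (z₀ - x₀))) atTop (𝓝 0) := by
      have := ((tendsto_pow_atTop_nhds_zero_of_lt_one hc0 hc).mul_const
        (N (z₀ - x₀))).const_mul m⁻¹
      simpa using this
    refine squeeze_zero (fun k => norm_nonneg _) (fun k => ?_) hlim
    rw [inv_mul_eq_div, le_div_iff₀ hm, mul_comm]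
    exact (hNm _).trans (h k).1

/-- The cone `β ≤ α` is kept by the nonlinear map near `x₀`, and `α` does not decrease on it. An
orbit started in the cone with `α > 0` therefore cannot tend to `x₀`, however close its start. -/
theorem not_locallyConverges_of_cone {R : X → X → Prop}
    (hR : ∀ᶠ z in 𝓝 x₀, ∀ z', R z z' ↔ z' = F z)
    (hF : HasFDerivAt F M x₀) (hx₀ : F x₀ = x₀) (α β : Seminorm ℝ X)
    (hN : ∀ x, (α ⊔ β) x = 0 → x = 0) {a : ℝ} (ha : 1 < a)
    (hα : ∀ x, a * α x ≤ α (M x)) (hβ : ∀ x, β (M x) ≤ max (α x) (β x))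
    {x : X} (hx : 0 < α x) (hxβ : β x ≤ α x) : ¬ LocallyConverges R x₀ := by
  intro hconv
  -- With `δ = (a - 1) / 2` the expansion bound `a - δ` for `α` equals the growth bound `1 + δ` for
  -- `β`, which is exactly what cone invariance requires.
  have hδ : 0 < (a - 1) / 2 := by linarith
  obtain ⟨U, hU, h⟩ := hconv _ (hR.and (hF.eventually_seminorm_sub_le hx₀ (α ⊔ β) hN hδ))
  have ht : Tendsto (fun t : ℝ => x₀ + t • x) (𝓝[>] 0) (𝓝 x₀) := by
    have : Continuous fun t : ℝ => x₀ + t • x := by fun_prop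
    have := this.tendsto 0
    rw [zero_smul, add_zero] at this
    exact this.mono_left nhdsWithin_le_nhds
  obtain ⟨t, htU, ht0⟩ := ((ht.eventually hU).and self_mem_nhdsWithin).exists
  have ht0' : (0 : ℝ) < t := ht0
  obtain ⟨⟨z, hz, hz0⟩, hall⟩ := h _ htU
  obtain ⟨hV, hlim⟩ := hall z hz hz0
  have hcone : ∀ k, β (z k - x₀) ≤ α (z k - x₀) ∧ t * α x ≤ α (z k - x₀) := by
    intro k
    induction k with
    | zero =>
      rw [hz0, add_sub_cancel_left, map_smul_eq_mul, map_smul_eq_mul, Real.norm_of_nonneg ht0'.le]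
      exact ⟨mul_le_mul_of_nonneg_left hxβ ht0'.le, le_rfl⟩
    | succ k ih =>
      obtain ⟨hRk, herr⟩ := hV k
      rw [(hRk _).1 (hz k)]
      set y := z k - x₀
      set w := F (z k) - x₀
      rw [Seminorm.sup_apply, Seminorm.sup_apply, max_eq_left ih.1] at herr
      have hα1 := (le_max_left _ _).trans herr
      have hβ1 := (le_max_right _ _).trans herr
      have h1 := hα y
      have h2 := hβ y
      rw [max_eq_left ih.1] at h2
      have h3 : α (M y) ≤ α w + α (w - M y) := by
        have := map_sub_le_add α w (w - M y)
        rwa [sub_sub_cancel] at this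
      have h4 : β w ≤ β (w - M y) + β (M y) := by
        have := map_add_le_add β (w - M y) (M y)
        rwa [sub_add_cancel] at this
      have h5 : 0 ≤ α y := apply_nonneg α y
      constructor <;> nlinarith [ih.2]
  have hlim' : Tendsto (fun k => α (z k - x₀)) atTop (𝓝 0) := by
    have := (α.continuous_of_finiteDimensional.tendsto 0).comp
      (tendsto_sub_nhds_zero_iff.2 hlim)
    simpa [Function.comp_def] using this
  exact absurd (ge_of_tendsto' hlim' fun k => (hcone k).2) (not_le.2 (by positivity))

end LocalDynamics

/-! ### Linear maps whose square is controlled by a diagonal quotient -/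

section ReducedMap

variable {X : Type*} [NormedAddCommGroup X] [NormedSpace ℝ X] {m : ℕ}

/-- If `l ∘ M = -d l` with `‖d‖ ≤ κ` and `M²` is controlled by `l`, then `M` contracts with factor
`κ` in some norm. -/
theorem exists_seminorm_map_le (M : X →L[ℝ] X) (l : X →ₗ[ℝ] (Fin m → ℝ)) (d : Fin m → ℝ)
    (hl : ∀ x, l (M x) = -(d * l x)) {C : ℝ} (hC : ∀ x, ‖M (M x)‖ ≤ C * ‖l x‖)
    {κ : ℝ} (hκ : 0 < κ) (hd : ‖d‖ ≤ κ) :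
    ∃ N : Seminorm ℝ X, (∀ x, N x = 0 → x = 0) ∧ ∀ x, N (M x) ≤ κ * N x := by
  have hC' : 0 < |C| + 1 := by positivity
  -- The norm is the maximum of `‖l x‖`, `ε * ‖M x‖` and `η * ‖x‖`. The weights make each term at `M
  -- x` at most `κ` times a term at `x`: `ε` absorbs `C`, and `η = κ * ε` passes the third term to
  -- the second. Thus `κ` itself is attained, with no loss.
  obtain ⟨ε, hε⟩ : ∃ ε : NNReal, (ε : ℝ) = κ / (|C| + 1) := ⟨⟨_, by positivity⟩, rfl⟩
  obtain ⟨η, hη⟩ : ∃ η : NNReal, (η : ℝ) = κ * ε := ⟨⟨κ * ε, by positivity⟩, rfl⟩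
  have hε0 : 0 < (ε : ℝ) := by rw [hε]; positivity
  have hη0 : 0 < (η : ℝ) := by rw [hη]; positivity
  refine ⟨(normSeminorm ℝ _).comp l ⊔ (ε • (normSeminorm ℝ X).comp (M : X →ₗ[ℝ] X) ⊔
    η • normSeminorm ℝ X),
    fun x hx => ?_, fun x => ?_⟩
  · simp only [Seminorm.sup_apply, _root_.smul_apply, NNReal.smul_def, smul_eq_mul,
      coe_normSeminorm] at hx
    have : (η : ℝ) * ‖x‖ ≤ 0 := hx ▸ (le_max_right _ _).trans (le_max_right _ _)
    exact norm_le_zero_iff.1 (le_of_mul_le_mul_left (by simpa using this) hη0)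
  · simp only [Seminorm.sup_apply, _root_.smul_apply, Seminorm.comp_apply, NNReal.smul_def,
      smul_eq_mul, coe_normSeminorm, ContinuousLinearMap.coe_coe]
    have e1 : ‖l (M x)‖ ≤ κ * ‖l x‖ := by
      rw [hl, norm_neg]
      exact (norm_mul_le _ _).trans (by gcongr)
    have e2 : ε * ‖M (M x)‖ ≤ κ * ‖l x‖ := by
      have : ‖M (M x)‖ ≤ (|C| + 1) * ‖l x‖ := (hC x).trans (by
        gcongr; linarith [le_abs_self C])
      calc ε * ‖M (M x)‖ ≤ ε * ((|C| + 1) * ‖l x‖) := by gcongr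
        _ = κ * ‖l x‖ := by rw [hε]; field_simp
    have e3 : η * ‖M x‖ = κ * (ε * ‖M x‖) := by rw [hη]; ring
    refine max_le (e1.trans ?_) (max_le (e2.trans ?_) (e3.le.trans ?_))
    · gcongr; exact le_max_left _ _
    · gcongr; exact le_max_left _ _
    · gcongr; exact (le_max_left _ _).trans (le_max_right _ _)

theorem exists_one_lt_forall_le_abs {m : ℕ} (d : Fin m → ℝ) :
    ∃ a : ℝ, 1 < a ∧ ∀ i, 1 < |d i| → a ≤ |d i| := by
  have h : ∀ s : Finset (Fin m), ∃ a : ℝ, 1 < a ∧ ∀ i ∈ s, 1 < |d i| → a ≤ |d i| := by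
    intro s
    induction s using Finset.induction_on with
    -- Any number above `1` serves when there is no expanding entry.
    | empty => exact ⟨2, one_lt_two, by simp⟩
    | insert i s _ ih =>
      obtain ⟨a, ha, h⟩ := ih
      by_cases hi : 1 < |d i|
      · refine ⟨min a |d i|, lt_min ha hi, fun j hj hj1 => ?_⟩
        rcases Finset.mem_insert.1 hj with rfl | hj
        · exact min_le_right _ _
        · exact (min_le_left _ _).trans (h j hj hj1)
      · refine ⟨a, ha, fun j hj hj1 => ?_⟩
        rcases Finset.mem_insert.1 hj with rfl | hj
        · exact absurd hj1 hi
        · exact h j hj hj1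
  obtain ⟨a, ha, h⟩ := h Finset.univ
  exact ⟨a, ha, fun i => h i (Finset.mem_univ i)⟩

/-- Splitting the coordinates of `l` at modulus `1` gives the seminorms for the cone argument: `α`
measures the expanding ones, with a uniform factor since there are finitely many; `β` measures the
others together with `M x` and `x`, so that `α ⊔ β` is a norm. -/
theorem not_locallyConverges_of_one_lt_abs [FiniteDimensional ℝ X] {F : X → X} {M : X →L[ℝ] X}
    {x₀ : X} {R : X → X → Prop} (hR : ∀ᶠ z in 𝓝 x₀, ∀ z', R z z' ↔ z' = F z)
    (hF : HasFDerivAt F M x₀) (hx₀ : F x₀ = x₀)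
    (l : X →ₗ[ℝ] (Fin m → ℝ)) (d : Fin m → ℝ)
    (hl : ∀ x, l (M x) = -(d * l x)) {C : ℝ} (hC : ∀ x, ‖M (M x)‖ ≤ C * ‖l x‖)
    {lam : ℝ} (hlam : 1 < |lam|) {x : X} (hx : x ≠ 0) (hMx : M x = lam • x) :
    ¬ LocallyConverges R x₀ := by
  obtain ⟨a, ha, hgap⟩ := exists_one_lt_forall_le_abs d
  have hC' : 0 < |C| + 1 := by positivity
  obtain ⟨ε, hε⟩ : ∃ ε : NNReal, (ε : ℝ) = 1 / (|C| + 1) := ⟨⟨_, by positivity⟩, rfl⟩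
  have hε0 : 0 < (ε : ℝ) := by rw [hε]; positivity
  let u : Fin m → ℝ := fun i => if 1 < |d i| then 1 else 0
  let s : Fin m → ℝ := fun i => if 1 < |d i| then 0 else 1
  let lu := (LinearMap.mulLeft ℝ u).comp l
  let ls := (LinearMap.mulLeft ℝ s).comp l
  have hlu : ∀ x i, lu x i = if 1 < |d i| then l x i else 0 := fun x i => by simp [lu, u]
  have hls : ∀ x i, ls x i = if 1 < |d i| then 0 else l x i := fun x i => by simp [ls, s]
  have hnorm : ∀ x, ‖l x‖ ≤ max ‖lu x‖ ‖ls x‖ := fun x => by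
    refine (pi_norm_le_iff_of_nonneg (le_max_of_le_left (norm_nonneg _))).2 fun i => ?_
    by_cases hi : 1 < |d i|
    · have := norm_le_pi_norm (lu x) i
      rw [hlu, if_pos hi] at this
      exact this.trans (le_max_left _ _)
    · have := norm_le_pi_norm (ls x) i
      rw [hls, if_neg hi] at this
      exact this.trans (le_max_right _ _)
  let α : Seminorm ℝ X := (normSeminorm ℝ _).comp lu
  let β : Seminorm ℝ X := (normSeminorm ℝ _).comp ls ⊔
    (ε • (normSeminorm ℝ X).comp (M : X →ₗ[ℝ] X) ⊔ ε • normSeminorm ℝ X)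
  have hαx : ∀ x, α x = ‖lu x‖ := fun x => rfl
  have hβx : ∀ x, β x = max ‖ls x‖ (max (ε * ‖M x‖) (ε * ‖x‖)) := fun x => rfl
  have hN : ∀ x, (α ⊔ β) x = 0 → x = 0 := fun x hx => by
    rw [Seminorm.sup_apply, hβx] at hx
    have : (ε : ℝ) * ‖x‖ ≤ 0 :=
      hx ▸ (le_max_right _ _).trans ((le_max_right _ _).trans (le_max_right _ _))
    exact norm_le_zero_iff.1 (le_of_mul_le_mul_left (by simpa using this) hε0)
  have hα : ∀ x, a * α x ≤ α (M x) := fun x => by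
    rw [hαx, hαx, mul_comm, ← le_div_iff₀ (by linarith)]
    refine (pi_norm_le_iff_of_nonneg (by positivity)).2 fun i => ?_
    rw [le_div_iff₀ (by linarith), hlu]
    split_ifs with hi
    · have h1 := norm_le_pi_norm (lu (M x)) i
      rw [hlu, if_pos hi, hl, Pi.neg_apply, norm_neg, Pi.mul_apply, norm_mul] at h1
      refine le_trans ?_ h1
      rw [mul_comm]
      exact mul_le_mul_of_nonneg_right (hgap i hi) (norm_nonneg _)
    · simp
  have hβ : ∀ x, β (M x) ≤ max (α x) (β x) := fun x => by
    have hls' : ‖ls (M x)‖ ≤ ‖ls x‖ := by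
      refine (pi_norm_le_iff_of_nonneg (norm_nonneg _)).2 fun i => ?_
      refine le_trans ?_ (norm_le_pi_norm (ls x) i)
      rw [hls, hls]
      split_ifs with hi
      · simp
      · rw [hl, Pi.neg_apply, norm_neg, Pi.mul_apply, norm_mul]
        exact mul_le_of_le_one_left (norm_nonneg _) (not_lt.1 hi)
    have e2 : ε * ‖M (M x)‖ ≤ ‖l x‖ := by
      have : ‖M (M x)‖ ≤ (|C| + 1) * ‖l x‖ := (hC x).trans (by
        gcongr; linarith [le_abs_self C])
      calc ε * ‖M (M x)‖ ≤ ε * ((|C| + 1) * ‖l x‖) := by gcongr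
        _ = ‖l x‖ := by rw [hε]; field_simp
    rw [hβx, hβx, hαx]
    refine max_le ?_ (max_le ?_ ?_)
    · exact hls'.trans ((le_max_left _ _).trans (le_max_right _ _))
    · exact e2.trans ((hnorm x).trans (max_le_max le_rfl (le_max_left _ _)))
    · exact ((le_max_left _ _).trans (le_max_right _ _)).trans (le_max_right _ _)
  -- Were the eigenvector outside the cone, `hβ` would give `|lam| * β x ≤ β x` with `β x > 0`,
  -- contrary to `|lam| > 1`.
  have hcone : β x ≤ α x := by
    by_contra! h
    have h1 := hβ x
    rw [hMx, map_smul_eq_mul, max_eq_right h.le, Real.norm_eq_abs] at h1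
    have h2 : 0 ≤ α x := apply_nonneg α x
    nlinarith
  refine not_locallyConverges_of_cone hR hF hx₀ α β hN ha hα hβ
    (lt_of_le_of_ne (apply_nonneg α x) fun h => hx (hN x ?_)) hcone
  rw [Seminorm.sup_apply, max_eq_left hcone, h]

end ReducedMap

/-- Since `u` vanishes at `x₀`, the term `(A x - A x₀) *ᵥ u x` is `o(1) · O(‖x - x₀‖)`.
Differentiability of `A` is not needed, which matters because `W` is only continuous. -/
theorem HasFDerivAt.mulVec_of_eq_zero {X : Type*} [NormedAddCommGroup X] [NormedSpace ℝ X]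
    {ι κ : Type*} [Fintype ι] [Fintype κ] {A : X → Matrix ι κ ℝ} {u : X → κ → ℝ}
    {u' : X →L[ℝ] (κ → ℝ)} {x₀ : X} (hA : ContinuousAt A x₀) (hu : HasFDerivAt u u' x₀)
    (hu₀ : u x₀ = 0) :
    HasFDerivAt (fun x => A x *ᵥ u x)
      ((LinearMap.toContinuousLinearMap (A x₀).mulVecLin).comp u') x₀ := by
  rw [hasFDerivAt_pi']
  intro i
  have hterm : ∀ j, HasFDerivAt (fun x => A x i j * u x j)
      (A x₀ i j • (ContinuousLinearMap.proj j).comp u') x₀ := fun j => by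
    have hAij : ContinuousAt (fun x => A x i j) x₀ :=
      continuousAt_pi.1 (continuousAt_pi.1 hA i) j
    have huj : HasFDerivAt (fun x => u x j) ((ContinuousLinearMap.proj j).comp u') x₀ :=
      hasFDerivAt_pi'.1 hu j
    have h0 : u x₀ j = 0 := congrFun hu₀ j
    rw [hasFDerivAt_iff_isLittleO]
    have h1 : (fun x => (A x i j - A x₀ i j) * u x j) =o[𝓝 x₀] fun x => (1 : ℝ) * ‖x - x₀‖ := by
      refine Asymptotics.IsLittleO.mul_isBigO ?_ ?_
      · rw [Asymptotics.isLittleO_one_iff]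
        exact tendsto_sub_nhds_zero_iff.2 hAij
      · have := huj.isBigO_sub
        simp only [h0, sub_zero] at this
        exact this.norm_right
    have h2 := (hasFDerivAt_iff_isLittleO.1 huj).const_mul_left (A x₀ i j)
    simp only [one_mul] at h1
    refine (h1.of_norm_right.add h2).congr_left fun x => ?_
    simp only [h0, _root_.smul_apply, smul_eq_mul]
    ring
  have hsum := HasFDerivAt.fun_sum (u := Finset.univ) fun j _ => hterm j
  refine (hsum.congr_fderiv ?_)
  ext x
  simp [mulVec, dotProduct]

/-! ### Reduction of the QP subproblem to a linear KKT system -/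

namespace SQPMethod

variable {nv ng nh : ℕ} (S : SQPMethod nv ng nh)

theorem GTilde_mulVec (vs v : Fin nv → ℝ) (l : S.ActiveIdx vs → ℝ) :
    S.GTilde vs v *ᵥ l = S.G v *ᵥ (fun j => l (Sum.inl j)) +
      S.H v *ᵥ fun i => if hi : S.h vs i = 0 then l (Sum.inr ⟨i, hi⟩) else 0 := by
  ext j
  simp only [mulVec, dotProduct, Pi.add_apply, Fintype.sum_sum_type, GTilde, of_apply,
    Sum.elim_inl, Sum.elim_inr]
  congr 1
  rw [← Fintype.sum_subtype_add_sum_subtype (fun i => S.h vs i = 0) fun i => S.H v j i *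
    if hi : S.h vs i = 0 then l (Sum.inr ⟨i, hi⟩) else 0]
  rw [Finset.sum_eq_zero (s := (Finset.univ : Finset {i // ¬ S.h vs i = 0})) fun i _ => by
    rw [dif_neg i.2, mul_zero], add_zero]
  exact Finset.sum_congr rfl fun i _ => by rw [dif_pos i.2]

theorem GTilde_mulVec_of_eq_zero (vs v : Fin nv → ℝ) (l : Fin ng → ℝ) (m : Fin nh → ℝ)
    (hm : ∀ i, S.h vs i ≠ 0 → m i = 0) :
    S.GTilde vs v *ᵥ (Sum.elim l fun i => m i.1) = S.G v *ᵥ l + S.H v *ᵥ m := by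
  rw [GTilde_mulVec]
  congr 2
  ext i
  split_ifs with hi
  · rfl
  · exact (hm i hi).symm

theorem GTilde_transpose_mulVec (vs v w : Fin nv → ℝ) :
    (S.GTilde vs v)ᵀ *ᵥ w =
      Sum.elim ((S.G v)ᵀ *ᵥ w) fun i => ((S.H v)ᵀ *ᵥ w) i.1 := by
  ext i
  rcases i with i | i <;> rfl

/-- The KKT matrix at `z` of the QP subproblem, with the active set taken at `vs`. -/
noncomputable def kktMatrix (vs : Fin nv → ℝ) (z : PrimalDual nv ng nh) :
    Matrix (Fin nv ⊕ S.ActiveIdx vs) (Fin nv ⊕ S.ActiveIdx vs) ℝ :=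
  fromBlocks (S.W z) (S.GTilde vs z.1) (S.GTilde vs z.1)ᵀ 0

theorem kktMatrix_mulVec (vs : Fin nv → ℝ) (z : PrimalDual nv ng nh)
    (y : Fin nv ⊕ S.ActiveIdx vs → ℝ) :
    S.kktMatrix vs z *ᵥ y = Sum.elim
      (S.W z *ᵥ (y ∘ Sum.inl) + S.GTilde vs z.1 *ᵥ (y ∘ Sum.inr))
      ((S.GTilde vs z.1)ᵀ *ᵥ (y ∘ Sum.inl)) := by
  rw [kktMatrix, fromBlocks_mulVec, zero_mulVec, add_zero]

/-- Extension of a primal vector and multipliers of the active constraints by zero. -/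
noncomputable def embed (vs : Fin nv → ℝ) :
    (Fin nv ⊕ S.ActiveIdx vs → ℝ) →ₗ[ℝ] PrimalDual nv ng nh where
  toFun y := (fun j => y (Sum.inl j), fun j => y (Sum.inr (Sum.inl j)),
    fun i => if hi : S.h vs i = 0 then y (Sum.inr (Sum.inr ⟨i, hi⟩)) else 0)
  map_add' y y' := by
    refine Prod.ext rfl (Prod.ext rfl ?_)
    ext i
    by_cases hi : S.h vs i = 0 <;> simp [hi]
  map_smul' c y := by
    refine Prod.ext rfl (Prod.ext rfl ?_)
    ext i
    by_cases hi : S.h vs i = 0 <;> simp [hi]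

theorem embed_snd_snd_of_ne {vs : Fin nv → ℝ} (y : Fin nv ⊕ S.ActiveIdx vs → ℝ) {i : Fin nh}
    (hi : S.h vs i ≠ 0) : (S.embed vs y).2.2 i = 0 := dif_neg hi

variable {S}

/-- Uniqueness of KKT points of the convex QP subproblem. -/
theorem IsStep.eq_of_strict {vs : Fin nv → ℝ} {z z' z'' : PrimalDual nv ng nh}
    (h' : S.IsStep z z') (h'' : S.IsStep z z'') (hK : IsUnit (S.kktMatrix vs z))
    (hact : ∀ i, S.h vs i = 0 → 0 < z'.2.2 i)
    (hinact : ∀ i, S.h vs i ≠ 0 → (S.h z.1 + (S.H z.1)ᵀ *ᵥ (z'.1 - z.1)) i < 0) :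
    z'' = z' := by
  obtain ⟨s1', e1', i1', p1', c1'⟩ := h'
  obtain ⟨s1'', e1'', i1'', p1'', c1''⟩ := h''
  set t' := S.h z.1 + (S.H z.1)ᵀ *ᵥ (z'.1 - z.1) with ht'
  set t'' := S.h z.1 + (S.H z.1)ᵀ *ᵥ (z''.1 - z.1) with ht''
  set w := z''.1 - z'.1 with hw
  have hwd : w = (z''.1 - z.1) - (z'.1 - z.1) := by rw [hw]; abel
  have hG : (S.G z.1)ᵀ *ᵥ w = 0 := by
    rw [hwd, mulVec_sub]
    have := congrArg₂ (· - ·) e1'' e1'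
    simpa using this
  have hH : (S.H z.1)ᵀ *ᵥ w = t'' - t' := by
    rw [hwd, mulVec_sub, ht', ht'']; abel
  have hstat : S.W z *ᵥ w + S.G z.1 *ᵥ (z''.2.1 - z'.2.1) + S.H z.1 *ᵥ (z''.2.2 - z'.2.2) = 0 := by
    rw [hwd, mulVec_sub _ (z''.1 - z.1), mulVec_sub _ z''.2.1, mulVec_sub _ z''.2.2]
    have := congrArg₂ (· - ·) s1'' s1'
    simp only [sub_zero] at this
    rw [← this]; abel
  -- Testing the difference of the two stationarity equations with `w` gives a sum of two
  -- nonnegative terms: the first by semidefiniteness, the second by complementarity and signs. So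
  -- both vanish, as do the cross products of multipliers and slacks.
  have hquad : w ⬝ᵥ (S.W z *ᵥ w) + (t'' - t') ⬝ᵥ (z''.2.2 - z'.2.2) = 0 := by
    have := congrArg (fun u => w ⬝ᵥ u) hstat
    simp only [dotProduct_add, dotProduct_zero, dotProduct_mulVec w (S.G z.1),
      dotProduct_mulVec w (S.H z.1), ← mulVec_transpose, hG, hH, zero_dotProduct,
      add_zero] at this
    exact this
  have hterm : ∀ i, 0 ≤ (t'' - t') i * (z''.2.2 - z'.2.2) i := fun i => by
    have a1 := c1' i; have a2 := c1'' i
    have b1 : t' i ≤ 0 := i1' i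
    have b2 : t'' i ≤ 0 := i1'' i
    have d1 : 0 ≤ z'.2.2 i := p1' i
    have d2 : 0 ≤ z''.2.2 i := p1'' i
    simp only [Pi.sub_apply]
    nlinarith [mul_nonneg d1 (neg_nonneg.2 b2), mul_nonneg d2 (neg_nonneg.2 b1)]
  have hWnn : 0 ≤ w ⬝ᵥ (S.W z *ᵥ w) := by
    simpa using (S.posSemidef_W z).dotProduct_mulVec_nonneg w
  have hsnn : 0 ≤ (t'' - t') ⬝ᵥ (z''.2.2 - z'.2.2) := Finset.sum_nonneg fun i _ => hterm i
  have hW0 : S.W z *ᵥ w = 0 := by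
    have h0 : w ⬝ᵥ (S.W z *ᵥ w) = 0 := by linarith
    exact ((S.posSemidef_W z).dotProduct_mulVec_zero_iff w).1 (by simpa using h0)
  have hs0 : ∀ i, (t'' - t') i * (z''.2.2 - z'.2.2) i = 0 := fun i => by
    have h0 : (t'' - t') ⬝ᵥ (z''.2.2 - z'.2.2) = 0 := by linarith
    exact (Finset.sum_eq_zero_iff_of_nonneg fun i _ => hterm i).1 h0 i (Finset.mem_univ i)
  have hprod : ∀ i, z'.2.2 i * t'' i = 0 ∧ z''.2.2 i * t' i = 0 := fun i => by
    have a1 := c1' i; have a2 := c1'' i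
    have b1 : t' i ≤ 0 := i1' i
    have b2 : t'' i ≤ 0 := i1'' i
    have d1 : 0 ≤ z'.2.2 i := p1' i
    have d2 : 0 ≤ z''.2.2 i := p1'' i
    have := hs0 i
    simp only [Pi.sub_apply] at this
    constructor <;>
      nlinarith [mul_nonneg d1 (neg_nonneg.2 b2), mul_nonneg d2 (neg_nonneg.2 b1)]
  have hHact : ∀ i, S.h vs i = 0 → ((S.H z.1)ᵀ *ᵥ w) i = 0 := fun i hi => by
    have hpos := (hact i hi).ne'
    have a1 : t' i = 0 := (mul_eq_zero.1 (c1' i)).resolve_left hpos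
    have a2 : t'' i = 0 := (mul_eq_zero.1 (hprod i).1).resolve_left hpos
    rw [hH, Pi.sub_apply, a1, a2, sub_zero]
  have hmu : ∀ i, S.h vs i ≠ 0 → (z''.2.2 - z'.2.2) i = 0 := fun i hi => by
    have hneg := (hinact i hi).ne
    rw [Pi.sub_apply, (mul_eq_zero.1 (hprod i).2).resolve_right hneg,
      (mul_eq_zero.1 (c1' i)).resolve_right hneg, sub_zero]
  -- Semidefiniteness of `W` gives only `W w = 0`, not `w = 0`; the invertible KKT matrix finishes
  -- the argument.
  have hK0 : S.kktMatrix vs z *ᵥ Sum.elim w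
      (Sum.elim (z''.2.1 - z'.2.1) fun i => (z''.2.2 - z'.2.2) i.1) = 0 := by
    rw [kktMatrix_mulVec, Sum.elim_comp_inl, Sum.elim_comp_inr,
      GTilde_mulVec_of_eq_zero S vs z.1 _ _ hmu, GTilde_transpose_mulVec, ← add_assoc, hstat, hG]
    ext i
    rcases i with i | i | i
    · rfl
    · rfl
    · exact hHact i.1 i.2
  have hy := (mulVec_injective_iff_isUnit.2 hK) (hK0.trans (mulVec_zero _).symm)
  refine Prod.ext (sub_eq_zero.1 ?_) (Prod.ext (sub_eq_zero.1 ?_) (sub_eq_zero.1 ?_))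
  · ext i; exact congrFun hy (Sum.inl i)
  · ext i; exact congrFun hy (Sum.inr (Sum.inl i))
  · ext i
    by_cases hi : S.h vs i = 0
    · exact congrFun hy (Sum.inr (Sum.inr ⟨i, hi⟩))
    · exact hmu i hi

variable (S)

/-- Residual at `z` of the point `zs` in the linear system of the QP subproblem. -/
noncomputable def residual (zs z : PrimalDual nv ng nh) : Fin nv ⊕ S.ActiveIdx zs.1 → ℝ :=
  Sum.elim
    (S.W z *ᵥ (z.1 - zs.1) - (S.q z + S.GTilde zs.1 z.1 *ᵥ S.multTilde zs))
    ((S.GTilde zs.1 z.1)ᵀ *ᵥ (z.1 - zs.1) - S.gTilde zs.1 z.1)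

/-- The local solution map of the iteration near `zs`. -/
noncomputable def stepMap (zs z : PrimalDual nv ng nh) : PrimalDual nv ng nh :=
  zs + S.embed zs.1 ((S.kktMatrix zs.1 z)⁻¹ *ᵥ S.residual zs z)

variable {S}

/-- The linear system makes active constraints equalities and keeps inactive multipliers at zero, so
only strict signs remain to be assumed. These signs also give uniqueness. -/
theorem isStep_iff_eq_stepMap {zs z : PrimalDual nv ng nh} (hK : IsUnit (S.kktMatrix zs.1 z))
    (hmus : ∀ i, S.h zs.1 i ≠ 0 → zs.2.2 i = 0)
    (hact : ∀ i, S.h zs.1 i = 0 → 0 < (S.stepMap zs z).2.2 i)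
    (hinact : ∀ i, S.h zs.1 i ≠ 0 →
      (S.h z.1 + (S.H z.1)ᵀ *ᵥ ((S.stepMap zs z).1 - z.1)) i < 0)
    (z' : PrimalDual nv ng nh) : S.IsStep z z' ↔ z' = S.stepMap zs z := by
  set y := (S.kktMatrix zs.1 z)⁻¹ *ᵥ S.residual zs z with hy
  have hKy : S.kktMatrix zs.1 z *ᵥ y = S.residual zs z := by
    rw [hy, mulVec_mulVec, mul_nonsing_inv _ ((isUnit_iff_isUnit_det _).1 hK), one_mulVec]
  rw [kktMatrix_mulVec, residual, Sum.elim_eq_iff] at hKy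
  obtain ⟨e1, e2⟩ := hKy
  have hF1 : (S.stepMap zs z).1 - z.1 = y ∘ Sum.inl - (z.1 - zs.1) := by
    have : (S.stepMap zs z).1 = zs.1 + y ∘ Sum.inl := rfl
    rw [this]; abel
  have hmu0 : ∀ i, S.h zs.1 i ≠ 0 → (S.stepMap zs z).2.2 i = 0 := fun i hi => by
    have : (S.stepMap zs z).2.2 i = zs.2.2 i + (S.embed zs.1 y).2.2 i := rfl
    rw [this, hmus i hi, embed_snd_snd_of_ne _ _ hi, add_zero]
  have hmult : (Sum.elim (S.stepMap zs z).2.1 fun i => (S.stepMap zs z).2.2 i.1 :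
      S.ActiveIdx zs.1 → ℝ) = S.multTilde zs + y ∘ Sum.inr := by
    ext i
    rcases i with i | i
    · rfl
    · have : (S.stepMap zs z).2.2 i.1 = zs.2.2 i.1 + (S.embed zs.1 y).2.2 i.1 := rfl
      rw [Sum.elim_inr, this]
      change _ + dite _ _ _ = _
      rw [dif_pos i.2]
      rfl
  have hcon : S.gTilde zs.1 z.1 + (S.GTilde zs.1 z.1)ᵀ *ᵥ ((S.stepMap zs z).1 - z.1) = 0 := by
    rw [hF1, mulVec_sub, e2]; abel
  rw [GTilde_transpose_mulVec] at hcon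
  have hact0 : ∀ i, S.h zs.1 i = 0 →
      (S.h z.1 + (S.H z.1)ᵀ *ᵥ ((S.stepMap zs z).1 - z.1)) i = 0 := fun i hi =>
    congrFun hcon (Sum.inr ⟨i, hi⟩)
  have hstep : S.IsStep z (S.stepMap zs z) := by
    refine ⟨?_, ?_, fun i => ?_, fun i => ?_, fun i => ?_⟩
    · rw [add_assoc, ← GTilde_mulVec_of_eq_zero S zs.1 z.1 _ _ hmu0, hmult, hF1, mulVec_sub,
        mulVec_add, eq_sub_of_add_eq e1]
      abel
    · ext i; exact congrFun hcon (Sum.inl i)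
    · by_cases hi : S.h zs.1 i = 0
      · exact (hact0 i hi).le
      · exact (hinact i hi).le
    · by_cases hi : S.h zs.1 i = 0
      · exact (hact i hi).le
      · exact (hmu0 i hi).ge
    · by_cases hi : S.h zs.1 i = 0
      · rw [hact0 i hi, mul_zero]
      · rw [hmu0 i hi, zero_mul]
  exact ⟨fun h => hstep.eq_of_strict h hK hact hinact, fun h => h ▸ hstep⟩

end SQPMethod

/-! ### The step map near the fixed point and its derivative -/

namespace SQPMethod

variable {nv ng nh : ℕ} (S : SQPMethod nv ng nh) (zs : PrimalDual nv ng nh)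

section FixedPoint

variable {S zs}

theorem IsStep.inactive_mult_eq_zero (hfix : S.IsStep zs zs) {i : Fin nh}
    (hi : S.h zs.1 i ≠ 0) : zs.2.2 i = 0 := by
  have := hfix.2.2.2.2 i
  rw [sub_self, mulVec_zero, add_zero] at this
  exact (mul_eq_zero.1 this).resolve_right hi

theorem IsStep.h_nonpos (hfix : S.IsStep zs zs) (i : Fin nh) : S.h zs.1 i ≤ 0 := by
  have := hfix.2.2.1 i
  rwa [sub_self, mulVec_zero, add_zero] at this

theorem IsStep.residual_eq_zero (hfix : S.IsStep zs zs) : S.residual zs zs = 0 := by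
  have h1 := hfix.1
  have h2 := hfix.2.1
  rw [sub_self, mulVec_zero] at h1 h2
  rw [add_zero] at h2
  rw [zero_add, add_assoc, ← GTilde_mulVec_of_eq_zero S zs.1 zs.1 _ _
    fun i hi => hfix.inactive_mult_eq_zero hi] at h1
  rw [residual, sub_self, mulVec_zero, mulVec_zero]
  ext i
  rcases i with i | i | i
  · have h : S.q zs i + (S.GTilde zs.1 zs.1 *ᵥ S.multTilde zs) i = 0 := congrFun h1 i
    simp only [Sum.elim_inl, Pi.sub_apply, Pi.add_apply, Pi.zero_apply, h, sub_zero]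
  · have := congrFun h2 i
    simpa [gTilde] using this
  · have := i.2
    simpa [gTilde] using this

theorem IsStep.stepMap_self (hfix : S.IsStep zs zs) : S.stepMap zs zs = zs := by
  rw [stepMap, hfix.residual_eq_zero, mulVec_zero, map_zero, add_zero]

theorem mem_criticalCone_of_GTilde {w : Fin nv → ℝ}
    (hw : (S.GTilde zs.1 zs.1)ᵀ *ᵥ w = 0) : w ∈ S.criticalCone zs := by
  rw [GTilde_transpose_mulVec] at hw
  have hH : ∀ i, S.h zs.1 i = 0 → ((S.H zs.1)ᵀ *ᵥ w) i = 0 := fun i hi =>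
    congrFun hw (Sum.inr ⟨i, hi⟩)
  refine ⟨?_, fun i hi => ⟨(hH i hi).le, fun _ => hH i hi⟩⟩
  ext i; exact congrFun hw (Sum.inl i)

/-- The primal part of a null vector lies in the nullspace of `G̃_*ᵀ` and has zero `W_*`-energy, so
SOSC kills it; LICQ then kills the multipliers. -/
theorem SOSC.isUnit_K (hS : S.SOSC zs) (hL : S.LICQ zs) : IsUnit (S.K zs) := by
  rw [← mulVec_injective_iff_isUnit]
  change Function.Injective (S.K zs).mulVecLin
  rw [← LinearMap.ker_eq_bot, LinearMap.ker_eq_bot']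
  intro y hy
  change S.kktMatrix zs.1 zs *ᵥ y = 0 at hy
  rw [kktMatrix_mulVec, ← Sum.elim_zero_zero, Sum.elim_eq_iff] at hy
  obtain ⟨h1, h2⟩ := hy
  have hv : y ∘ Sum.inl = 0 := by
    by_contra hne
    have hpos := hS.2 _ (mem_criticalCone_of_GTilde h2) hne
    have := congrArg (fun u => (y ∘ Sum.inl) ⬝ᵥ u) h1
    simp only [dotProduct_add, dotProduct_mulVec _ (S.GTilde zs.1 zs.1), ← mulVec_transpose, h2,
      zero_dotProduct, dotProduct_zero, add_zero] at this
    exact hpos.ne' this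
  rw [hv, mulVec_zero, zero_add] at h1
  have hl : y ∘ Sum.inr = 0 :=
    (mulVec_injective_iff.2 hL) (h1.trans (mulVec_zero _).symm)
  ext i
  rcases i with i | i
  · exact congrFun hv i
  · exact congrFun hl i

theorem differentiableAt_GTilde (hG : ∀ i j, DifferentiableAt ℝ (fun v => S.G v i j) zs.1)
    (hH : ∀ i j, DifferentiableAt ℝ (fun v => S.H v i j) zs.1) :
    ∀ i j, DifferentiableAt ℝ (fun v => S.GTilde zs.1 v i j) zs.1 := by
  intro i j
  rcases j with j | j
  · exact hG i j
  · exact hH i j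

theorem continuousAt_kktMatrix (hW : ContinuousAt S.W zs)
    (hG : ∀ i j, DifferentiableAt ℝ (fun v => S.G v i j) zs.1)
    (hH : ∀ i j, DifferentiableAt ℝ (fun v => S.H v i j) zs.1) :
    ContinuousAt (S.kktMatrix zs.1) zs := by
  have hGt : ∀ i j, ContinuousAt (fun z : PrimalDual nv ng nh => S.GTilde zs.1 z.1 i j) zs :=
    fun i j => ContinuousAt.comp (f := Prod.fst) (x := zs)
      (differentiableAt_GTilde hG hH i j).continuousAt continuousAt_fst
  refine continuousAt_pi.2 fun i => continuousAt_pi.2 fun j => ?_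
  rcases i with i | i <;> rcases j with j | j
  · exact continuousAt_pi.1 (continuousAt_pi.1 hW i) j
  · exact hGt i j
  · exact hGt j i
  · exact continuousAt_const

end FixedPoint

/-- Derivative of `q(z) + G̃(v) λ̃_* - W_* (v - v_*)` at `zs`. -/
noncomputable def gradDeriv : PrimalDual nv ng nh →L[ℝ] (Fin nv → ℝ) :=
  fderiv ℝ S.q zs +
    (fderiv ℝ (fun v => S.GTilde zs.1 v *ᵥ S.multTilde zs) zs.1 -
      LinearMap.toContinuousLinearMap (S.W zs).mulVecLin).comp
        (ContinuousLinearMap.fst ℝ _ _)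

/-- Solution of the linearised step: the primal-dual displacement caused by a perturbation `a` of
the gradient. -/
noncomputable def response : (Fin nv → ℝ) →ₗ[ℝ] PrimalDual nv ng nh where
  toFun a := S.embed zs.1 ((S.K zs)⁻¹ *ᵥ Sum.elim (-a) 0)
  map_add' a b := by
    rw [← map_add, ← mulVec_add]
    congr 2
    ext i; rcases i with i | i <;> simp [add_comm]
  map_smul' c a := by
    rw [RingHom.id_apply, ← map_smul, ← mulVec_smul]
    congr 2
    ext i; rcases i with i | i <;> simp

/-- Derivative of the step map at `zs`. -/
noncomputable def stepDeriv : PrimalDual nv ng nh →L[ℝ] PrimalDual nv ng nh :=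
  (LinearMap.toContinuousLinearMap (S.response zs)).comp (S.gradDeriv zs)

theorem stepDeriv_apply (x : PrimalDual nv ng nh) :
    S.stepDeriv zs x = S.response zs (S.gradDeriv zs x) := rfl

variable {S zs}

theorem hasFDerivAt_stepMap (hW : ContinuousAt S.W zs) (hq : DifferentiableAt ℝ S.q zs)
    (hG : ∀ i j, DifferentiableAt ℝ (fun v => S.G v i j) zs.1)
    (hH : ∀ i j, DifferentiableAt ℝ (fun v => S.H v i j) zs.1)
    (hfix : S.IsStep zs zs) (hK : IsUnit (S.K zs)) (hC : S.C zs = 0) :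
    HasFDerivAt (S.stepMap zs) (S.stepDeriv zs) zs := by
  have hfst : HasFDerivAt (fun z : PrimalDual nv ng nh => z.1 - zs.1)
      (ContinuousLinearMap.fst ℝ _ _) zs := hasFDerivAt_fst.sub_const _
  have hGt := differentiableAt_GTilde hG hH
  have hGl : DifferentiableAt ℝ (fun v => S.GTilde zs.1 v *ᵥ S.multTilde zs) zs.1 := by
    rw [differentiableAt_pi]
    intro i
    simp only [mulVec, dotProduct]
    exact DifferentiableAt.fun_sum fun j _ => (hGt i j).mul_const _
  have hGT : ContinuousAt (fun z : PrimalDual nv ng nh => (S.GTilde zs.1 z.1)ᵀ) zs :=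
    continuousAt_pi.2 fun i => continuousAt_pi.2 fun j =>
      ContinuousAt.comp (f := Prod.fst) (x := zs) (hGt j i).continuousAt continuousAt_fst
  have h1 := (hfst.mulVec_of_eq_zero hW (sub_self _)).sub
    (hq.hasFDerivAt.add (hGl.hasFDerivAt.comp zs (hasFDerivAt_fst (p := zs))))
  have hgt : DifferentiableAt ℝ (S.gTilde zs.1) zs.1 := by
    rw [differentiableAt_pi]
    rintro (i | i)
    · exact differentiableAt_pi.1 (S.contDiff_g.differentiable two_ne_zero zs.1) i
    · exact differentiableAt_pi.1 (S.contDiff_h.differentiable two_ne_zero zs.1) i.1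
  have h2 := (hfst.mulVec_of_eq_zero hGT (sub_self _)).sub
    (hgt.hasFDerivAt.comp zs (hasFDerivAt_fst (p := zs)))
  -- With `C_* = 0` the constraint block of the residual has zero derivative, so only the gradient
  -- block drives the linearised step.
  have hC' : (LinearMap.toContinuousLinearMap (S.GTilde zs.1 zs.1)ᵀ.mulVecLin) =
      fderiv ℝ (S.gTilde zs.1) zs.1 := by
    ext1 v
    have := congrArg (fun A => A *ᵥ v) (sub_eq_zero.1 hC)
    simp only [LinearMap.toMatrix'_mulVec] at this
    exact this.symm
  have hres : HasFDerivAt (S.residual zs)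
      (ContinuousLinearMap.pi (Sum.elim
        (fun i => (ContinuousLinearMap.proj i).comp (-(S.gradDeriv zs)))
        (fun _ => 0))) zs := by
    rw [hasFDerivAt_pi]
    rintro (i | i)
    · refine (hasFDerivAt_pi'.1 h1 i).congr_fderiv ?_
      rw [Sum.elim_inl, gradDeriv]
      refine ContinuousLinearMap.ext fun x => ?_
      simp
      ring
    · refine (hasFDerivAt_pi'.1 h2 i).congr_fderiv ?_
      rw [Sum.elim_inr, hC']
      refine ContinuousLinearMap.ext fun x => ?_
      simp
  have hKc : ContinuousAt (fun z => (S.kktMatrix zs.1 z)⁻¹) zs := by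
    refine ContinuousAt.comp (g := Inv.inv) ?_ (continuousAt_kktMatrix hW hG hH)
    refine continuousAt_matrix_inv _ ?_
    rw [Ring.inverse_eq_inv']
    exact continuousAt_inv₀ ((isUnit_iff_isUnit_det _).1 hK).ne_zero
  have h3 := hres.mulVec_of_eq_zero hKc hfix.residual_eq_zero
  have h4 := ((LinearMap.toContinuousLinearMap (S.embed zs.1)).hasFDerivAt.comp zs h3).const_add zs
  refine h4.congr_fderiv ?_
  refine ContinuousLinearMap.ext fun x => ?_
  rw [stepDeriv_apply]
  simp only [ContinuousLinearMap.comp_apply, LinearMap.coe_toContinuousLinearMap']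
  change S.embed zs.1 ((S.K zs)⁻¹ *ᵥ _) = S.embed zs.1 ((S.K zs)⁻¹ *ᵥ _)
  congr 2
  ext i
  rcases i with i | i <;> simp

theorem eventually_isStep_iff (hW : ContinuousAt S.W zs) (hq : DifferentiableAt ℝ S.q zs)
    (hG : ∀ i j, DifferentiableAt ℝ (fun v => S.G v i j) zs.1)
    (hH : ∀ i j, DifferentiableAt ℝ (fun v => S.H v i j) zs.1)
    (hfix : S.IsStep zs zs) (hK : IsUnit (S.K zs)) (hSC : S.StrictComplementarity zs)
    (hC : S.C zs = 0) :
    ∀ᶠ z in 𝓝 zs, ∀ z', S.IsStep z z' ↔ z' = S.stepMap zs z := by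
  have hF : ContinuousAt (S.stepMap zs) zs :=
    (hasFDerivAt_stepMap hW hq hG hH hfix hK hC).continuousAt
  have hF0 := hfix.stepMap_self
  have e1 : ∀ᶠ z in 𝓝 zs, IsUnit (S.kktMatrix zs.1 z) := by
    have hdet : ContinuousAt (fun z => (S.kktMatrix zs.1 z).det) zs :=
      ContinuousAt.comp (g := Matrix.det) continuous_id.matrix_det.continuousAt
        (continuousAt_kktMatrix hW hG hH)
    filter_upwards [hdet.eventually_ne ((isUnit_iff_isUnit_det _).1 hK).ne_zero] with z hz
    exact (isUnit_iff_isUnit_det _).2 hz.isUnit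
  have e2 : ∀ᶠ z in 𝓝 zs, ∀ i, S.h zs.1 i = 0 → 0 < (S.stepMap zs z).2.2 i := by
    rw [eventually_all]
    intro i
    rw [eventually_imp_distrib_left]
    intro hi
    have : ContinuousAt (fun z => (S.stepMap zs z).2.2 i) zs :=
      ((continuous_apply i).comp (continuous_snd.comp continuous_snd)).continuousAt.comp hF
    refine this.eventually (lt_mem_nhds ?_)
    beta_reduce
    rw [hF0]
    exact hSC i hi
  have e3 : ∀ᶠ z in 𝓝 zs, ∀ i, S.h zs.1 i ≠ 0 →
      (S.h z.1 + (S.H z.1)ᵀ *ᵥ ((S.stepMap zs z).1 - z.1)) i < 0 := by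
    rw [eventually_all]
    intro i
    rw [eventually_imp_distrib_left]
    intro hi
    have hHc : ∀ j, ContinuousAt (fun z : PrimalDual nv ng nh => S.H z.1 j i) zs := fun j =>
      ContinuousAt.comp (f := Prod.fst) (x := zs) (hH j i).continuousAt continuousAt_fst
    have hfst : ∀ j, Continuous fun z : PrimalDual nv ng nh => z.1 j := fun j =>
      (continuous_apply j).comp continuous_fst
    have hhc : ContinuousAt (fun z : PrimalDual nv ng nh => S.h z.1 i) zs :=
      ((continuous_apply i).comp (S.contDiff_h.continuous.comp continuous_fst)).continuousAt
    have : ContinuousAt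
        (fun z => (S.h z.1 + (S.H z.1)ᵀ *ᵥ ((S.stepMap zs z).1 - z.1)) i) zs := by
      refine hhc.add (tendsto_finsetSum Finset.univ fun j _ =>
        show ContinuousAt (fun z => S.H z.1 j i * ((S.stepMap zs z).1 j - z.1 j)) zs from
          (hHc j).mul (ContinuousAt.sub ((hfst j).continuousAt.comp hF) (hfst j).continuousAt))
    refine this.eventually (gt_mem_nhds ?_)
    beta_reduce
    rw [hF0, sub_self, mulVec_zero, add_zero]
    exact lt_of_le_of_ne (hfix.h_nonpos i) hi
  filter_upwards [e1, e2, e3] with z h1 h2 h3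
  exact isStep_iff_eq_stepMap h1 (fun i hi => hfix.inactive_mult_eq_zero hi) h2 h3

/-- On directions without inactive multipliers the gradient perturbation is `E_* v`. -/
theorem gradDeriv_apply (hq : DifferentiableAt ℝ S.q zs) (hD : S.D zs = 0)
    {x : PrimalDual nv ng nh} (hx : ∀ i, S.h zs.1 i ≠ 0 → x.2.2 i = 0) :
    S.gradDeriv zs x = S.E zs *ᵥ x.1 := by
  -- `D_* = 0` concerns active multipliers only. By `hx` the direction `(0, x.2)` moves only those:
  -- it is the image `J l` under the derivative of `withMultTilde`.
  have hdual : fderiv ℝ S.q zs ((0, x.2) : PrimalDual nv ng nh) = 0 := by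
    let l : S.ActiveIdx zs.1 → ℝ := Sum.elim x.2.1 fun i => x.2.2 i.1
    have hwith : ∀ t, S.withMultTilde zs t =
        (zs + S.embed zs.1 (Sum.elim 0 (t - S.multTilde zs)) : PrimalDual nv ng nh) := by
      intro t
      refine Prod.ext ?_ (Prod.ext ?_ ?_)
      · ext i; simp [withMultTilde, embed]
      · ext i; simp [withMultTilde, embed, multTilde]
      · ext i
        by_cases hi : S.h zs.1 i = 0 <;> simp [withMultTilde, embed, multTilde, hi]
    let J : (S.ActiveIdx zs.1 → ℝ) →L[ℝ] PrimalDual nv ng nh :=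
      LinearMap.toContinuousLinearMap ((S.embed zs.1).comp
        ({ toFun := fun t => Sum.elim 0 t
           map_add' := fun a b => by ext i; rcases i with i | i <;> simp
           map_smul' := fun c a => by ext i; rcases i with i | i <;> simp } :
          (S.ActiveIdx zs.1 → ℝ) →ₗ[ℝ] (Fin nv ⊕ S.ActiveIdx zs.1 → ℝ)))
    have hJ : HasFDerivAt (S.withMultTilde zs) J (S.multTilde zs) := by
      refine ((J.hasFDerivAt.sub_const (J (S.multTilde zs))).const_add zs).congr_of_eventuallyEq
        (Eventually.of_forall fun t => ?_)
      beta_reduce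
      rw [hwith, ← map_sub]
      rfl
    have h0 : S.withMultTilde zs (S.multTilde zs) = zs := by
      rw [hwith, sub_self, Sum.elim_zero_zero, map_zero, add_zero]
    have hq' : HasFDerivAt S.q (fderiv ℝ S.q zs) (S.withMultTilde zs (S.multTilde zs)) := by
      rw [h0]; exact hq.hasFDerivAt
    have hcomp := (hq'.comp (S.multTilde zs) hJ).fderiv
    have hz : fderiv ℝ (fun l => S.q (S.withMultTilde zs l)) (S.multTilde zs) = 0 := by
      have h := (LinearEquiv.map_eq_zero_iff _).1 hD
      exact ContinuousLinearMap.coe_inj.1 h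
    have h := congrArg (fun f => f l) (hcomp.symm.trans hz)
    have hJl : J l = (0, x.2) := by
      refine Prod.ext rfl (Prod.ext rfl ?_)
      ext i
      by_cases hi : S.h zs.1 i = 0
      · simp [J, l, embed, hi]
      · simp [J, l, embed, hi, hx i hi]
    simpa [hJl] using h
  have hprimal : fderiv ℝ (fun v => S.q (v, zs.2)) zs.1 x.1 =
      fderiv ℝ S.q zs ((x.1, 0) : PrimalDual nv ng nh) := by
    have h1 : HasFDerivAt (fun v : Fin nv → ℝ => ((v, zs.2) : PrimalDual nv ng nh))
        (ContinuousLinearMap.inl ℝ _ _) zs.1 := hasFDerivAt_prodMk_left _ _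
    have h2 : HasFDerivAt S.q (fderiv ℝ S.q zs) ((zs.1, zs.2) : PrimalDual nv ng nh) :=
      hq.hasFDerivAt
    have := (h2.comp zs.1 h1).fderiv
    exact congrArg (fun f => f x.1) this
  have hsplit : x = (x.1, 0) + (0, x.2) := by simp
  have hqx : fderiv ℝ S.q zs x = fderiv ℝ (fun v => S.q (v, zs.2)) zs.1 x.1 := by
    rw [hprimal]
    conv_lhs => rw [hsplit, map_add, hdual, add_zero]
  rw [E, Lam, sub_mulVec, add_mulVec, LinearMap.toMatrix'_mulVec, LinearMap.toMatrix'_mulVec]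
  simp only [gradDeriv, _root_.add_apply, ContinuousLinearMap.comp_apply,
    _root_.sub_apply, ContinuousLinearMap.coe_fst', hqx,
    LinearMap.coe_toContinuousLinearMap', mulVecLin_apply, ContinuousLinearMap.coe_coe]
  rw [add_sub_assoc]

end SQPMethod

/-! ### Diagonal coordinates for the linearised step -/

namespace SQPMethod

variable {nv ng nh nz : ℕ} {S : SQPMethod nv ng nh} {zs : PrimalDual nv ng nh}

/-- The columns of `Y` form a basis of the nullspace of `G̃_*ᵀ` that is orthonormal for `W_*` and
diagonalises `E_*`, with diagonal `d`. -/
structure IsDiagonalizingBasis (S : SQPMethod nv ng nh) (zs : PrimalDual nv ng nh)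
    (Y : Matrix (Fin nv) (Fin nz) ℝ) (d : Fin nz → ℝ) : Prop where
  transpose_mul : (S.GTilde zs.1 zs.1)ᵀ * Y = 0
  exists_eq_mulVec : ∀ w, (S.GTilde zs.1 zs.1)ᵀ *ᵥ w = 0 → ∃ p, w = Y *ᵥ p
  reduced_W : reduced Y (S.W zs) = 1
  reduced_E : reduced Y (S.E zs) = diagonal d

theorem IsNullspaceBasis.mulVec_eq_zero {Z : Matrix (Fin nv) (Fin nz) ℝ}
    (hZ : S.IsNullspaceBasis zs Z) (p : Fin nz → ℝ) :
    (S.GTilde zs.1 zs.1)ᵀ *ᵥ (Z *ᵥ p) = 0 := by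
  have : Z *ᵥ p ∈ LinearMap.ker (S.GTilde zs.1 zs.1)ᵀ.mulVecLin := by
    rw [← hZ.2, ← range_mulVecLin]
    exact ⟨p, rfl⟩
  exact this

theorem IsNullspaceBasis.exists_eq_mulVec {Z : Matrix (Fin nv) (Fin nz) ℝ}
    (hZ : S.IsNullspaceBasis zs Z) {w : Fin nv → ℝ} (hw : (S.GTilde zs.1 zs.1)ᵀ *ᵥ w = 0) :
    ∃ p, w = Z *ᵥ p := by
  have : w ∈ LinearMap.ker (S.GTilde zs.1 zs.1)ᵀ.mulVecLin := hw
  rw [← hZ.2, ← range_mulVecLin] at this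
  obtain ⟨p, hp⟩ := this
  exact ⟨p, hp.symm⟩

theorem SOSC.posDef_reduced_W (hS : S.SOSC zs) {Z : Matrix (Fin nv) (Fin nz) ℝ}
    (hZ : S.IsNullspaceBasis zs Z) : (reduced Z (S.W zs)).PosDef := by
  refine PosDef.of_dotProduct_mulVec_pos ?_ fun p hp => ?_
  · have := isHermitian_conjTranspose_mul_mul Z (S.posSemidef_W zs).1
    rwa [conjTranspose_eq_transpose_of_trivial] at this
  · have hne : Z *ᵥ p ≠ 0 := fun h =>
      hp ((mulVec_injective_iff.2 hZ.1) (h.trans (mulVec_zero _).symm))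
    have := hS.2 _ (mem_criticalCone_of_GTilde (hZ.mulVec_eq_zero p)) hne
    rwa [star_trivial, reduced, ← mulVec_mulVec, ← mulVec_mulVec, dotProduct_mulVec p,
      vecMul_transpose]

theorem IsNullspaceBasis.exists_isDiagonalizingBasis (hS : S.SOSC zs) (hE : (S.E zs).IsSymm)
    {Z : Matrix (Fin nv) (Fin nz) ℝ} (hZ : S.IsNullspaceBasis zs Z) :
    ∃ (T : Matrix (Fin nz) (Fin nz) ℝ) (d : Fin nz → ℝ), IsUnit T ∧
      Tᵀ * reduced Z (S.W zs) * T = 1 ∧ Tᵀ * reduced Z (S.E zs) * T = diagonal d ∧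
      S.IsDiagonalizingBasis zs (Z * T) d := by
  have hE' : (reduced Z (S.E zs)).IsSymm := by
    rw [IsSymm, reduced, transpose_mul, transpose_mul, transpose_transpose, hE.eq,
      Matrix.mul_assoc]
  obtain ⟨T, d, hT, h1, h2⟩ := exists_simultaneous_diagonalization (hS.posDef_reduced_W hZ) hE'
  have hred : ∀ A, reduced (Z * T) A = Tᵀ * reduced Z A * T := fun A => by
    simp only [reduced, transpose_mul, Matrix.mul_assoc]
  refine ⟨T, d, hT, h1, h2, ?_, fun w hw => ?_, (hred _).trans h1, (hred _).trans h2⟩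
  · apply Matrix.toLin'.injective
    refine LinearMap.ext fun p => ?_
    rw [toLin'_apply, ← mulVec_mulVec, ← mulVec_mulVec, hZ.mulVec_eq_zero, map_zero,
      LinearMap.zero_apply]
  · obtain ⟨p, rfl⟩ := hZ.exists_eq_mulVec hw
    refine ⟨T⁻¹ *ᵥ p, ?_⟩
    rw [mulVec_mulVec, Matrix.mul_assoc, mul_nonsing_inv _ ((isUnit_iff_isUnit_det _).1 hT),
      Matrix.mul_one]

variable {Y : Matrix (Fin nv) (Fin nz) ℝ} {d : Fin nz → ℝ}

/-- The upper left block of `K_*⁻¹` is `Y Yᵀ`. -/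
theorem IsDiagonalizingBasis.inv_K_mulVec_inl (hY : S.IsDiagonalizingBasis zs Y d)
    (hK : IsUnit (S.K zs)) (a : Fin nv → ℝ) :
    ((S.K zs)⁻¹ *ᵥ Sum.elim a 0) ∘ Sum.inl = Y *ᵥ (Yᵀ *ᵥ a) := by
  set y := (S.K zs)⁻¹ *ᵥ Sum.elim a 0 with hy
  have hKy : S.kktMatrix zs.1 zs *ᵥ y = Sum.elim a 0 := by
    change S.K zs *ᵥ y = _
    rw [hy, mulVec_mulVec, mul_nonsing_inv _ ((isUnit_iff_isUnit_det _).1 hK), one_mulVec]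
  rw [kktMatrix_mulVec, Sum.elim_eq_iff] at hKy
  obtain ⟨p, hp⟩ := hY.exists_eq_mulVec _ hKy.2
  have hGY : Yᵀ * S.GTilde zs.1 zs.1 = 0 := by
    have := congrArg Matrix.transpose hY.transpose_mul
    rwa [Matrix.transpose_mul, transpose_transpose, transpose_zero] at this
  have hW : Yᵀ * S.W zs * Y = 1 := hY.reduced_W
  rw [← hKy.1, mulVec_add, mulVec_mulVec _ Yᵀ (S.GTilde _ _), hGY, zero_mulVec, add_zero, hp,
    mulVec_mulVec _ _ Y, mulVec_mulVec _ Yᵀ, ← Matrix.mul_assoc, hW, one_mulVec]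

theorem IsDiagonalizingBasis.spectralRadius_iterationMatrix
    (hY : S.IsDiagonalizingBasis zs Y d) (hK : IsUnit (S.K zs)) (hC : S.C zs = 0)
    (hD : S.D zs = 0) :
    spectralRadius ℂ ((S.iterationMatrix zs).map (algebraMap ℝ ℂ)) = ENNReal.ofReal ‖d‖ := by
  have hA : S.iterationMatrix zs = ((S.K zs)⁻¹ *
      (fromRows 1 0 : Matrix (Fin nv ⊕ S.ActiveIdx zs.1) (Fin nv) ℝ)) *
      fromCols (S.E zs) 0 := by
    rw [iterationMatrix, L, hC, hD, Matrix.mul_assoc, fromRows_mul_fromCols]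
    simp
  rw [hA]
  -- The reversed product is `E_*` times the upper left block `Y Yᵀ` of `K_*⁻¹`, that is `(E_* Y)
  -- Yᵀ`; swapping once more gives `Yᵀ E_* Y`, which is diagonal.
  refine spectralRadius_mul_eq _ _ (S.E zs * Y) Yᵀ ?_ d ?_
  · apply Matrix.toLin'.injective
    refine LinearMap.ext fun a => ?_
    have h := hY.inv_K_mulVec_inl hK a
    have hU : (fromRows 1 0 : Matrix (Fin nv ⊕ S.ActiveIdx zs.1) (Fin nv) ℝ) *ᵥ a =
        Sum.elim a 0 := by
      rw [fromRows_mulVec, one_mulVec, zero_mulVec]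
    rw [toLin'_apply, toLin'_apply, ← mulVec_mulVec, ← mulVec_mulVec, hU, fromCols_mulVec,
      zero_mulVec, add_zero, h, mulVec_mulVec, mulVec_mulVec]
  · rw [← Matrix.mul_assoc]; exact hY.reduced_E

theorem IsDiagonalizingBasis.response_fst (hY : S.IsDiagonalizingBasis zs Y d)
    (hK : IsUnit (S.K zs)) (a : Fin nv → ℝ) : (S.response zs a).1 = -(Y *ᵥ (Yᵀ *ᵥ a)) := by
  rw [← mulVec_neg, ← mulVec_neg]
  exact hY.inv_K_mulVec_inl hK (-a)

/-- The gradient perturbation in the coordinates of `Y`. -/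
noncomputable def reducedGrad (S : SQPMethod nv ng nh) (zs : PrimalDual nv ng nh)
    (Y : Matrix (Fin nv) (Fin nz) ℝ) : PrimalDual nv ng nh →ₗ[ℝ] (Fin nz → ℝ) :=
  Yᵀ.mulVecLin.comp (S.gradDeriv zs : PrimalDual nv ng nh →ₗ[ℝ] (Fin nv → ℝ))

theorem reducedGrad_apply (x : PrimalDual nv ng nh) :
    reducedGrad S zs Y x = Yᵀ *ᵥ S.gradDeriv zs x := rfl

/-- A linearised step has no inactive multiplier component, so `gradDeriv_apply` applies to its
output though not to an arbitrary `x`. -/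
theorem IsDiagonalizingBasis.gradDeriv_stepDeriv (hY : S.IsDiagonalizingBasis zs Y d)
    (hK : IsUnit (S.K zs)) (hq : DifferentiableAt ℝ S.q zs) (hD : S.D zs = 0)
    (x : PrimalDual nv ng nh) :
    S.gradDeriv zs (S.stepDeriv zs x) = -(S.E zs *ᵥ (Y *ᵥ reducedGrad S zs Y x)) := by
  rw [stepDeriv_apply, gradDeriv_apply (x := S.response zs _) hq hD
    fun i hi => embed_snd_snd_of_ne S _ hi, hY.response_fst hK, mulVec_neg, reducedGrad_apply]

theorem IsDiagonalizingBasis.reducedGrad_stepDeriv (hY : S.IsDiagonalizingBasis zs Y d)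
    (hK : IsUnit (S.K zs)) (hq : DifferentiableAt ℝ S.q zs) (hD : S.D zs = 0)
    (x : PrimalDual nv ng nh) :
    reducedGrad S zs Y (S.stepDeriv zs x) = -(d * reducedGrad S zs Y x) := by
  have hE : Yᵀ * S.E zs * Y = diagonal d := hY.reduced_E
  rw [reducedGrad_apply, hY.gradDeriv_stepDeriv hK hq hD, mulVec_neg, mulVec_mulVec, mulVec_mulVec,
    hE]
  congr 1
  ext i
  exact mulVec_diagonal _ _ _

theorem IsDiagonalizingBasis.exists_norm_stepDeriv_le (hY : S.IsDiagonalizingBasis zs Y d)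
    (hK : IsUnit (S.K zs)) (hq : DifferentiableAt ℝ S.q zs) (hD : S.D zs = 0) :
    ∃ C : ℝ, ∀ x, ‖S.stepDeriv zs (S.stepDeriv zs x)‖ ≤ C * ‖reducedGrad S zs Y x‖ := by
  let Φ : (Fin nz → ℝ) →L[ℝ] PrimalDual nv ng nh := LinearMap.toContinuousLinearMap
    ((S.response zs).comp ((S.E zs).mulVecLin.comp Y.mulVecLin))
  refine ⟨‖Φ‖, fun x => ?_⟩
  rw [stepDeriv_apply S zs (S.stepDeriv zs x), hY.gradDeriv_stepDeriv hK hq hD, map_neg, norm_neg]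
  exact Φ.le_opNorm _

theorem IsDiagonalizingBasis.exists_eigenvector (hY : S.IsDiagonalizingBasis zs Y d)
    (hK : IsUnit (S.K zs)) (hq : DifferentiableAt ℝ S.q zs) (hD : S.D zs = 0)
    {i : Fin nz} (hi : d i ≠ 0) :
    ∃ x : PrimalDual nv ng nh, x ≠ 0 ∧ S.stepDeriv zs x = (-d i) • x := by
  let e : PrimalDual nv ng nh := (Y *ᵥ Pi.single i 1, 0)
  have hE : Yᵀ * S.E zs * Y = diagonal d := hY.reduced_E
  have hge : S.gradDeriv zs e = S.E zs *ᵥ (Y *ᵥ Pi.single i 1) :=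
    gradDeriv_apply hq hD fun _ _ => rfl
  have hle : reducedGrad S zs Y e = d i • Pi.single i 1 := by
    rw [reducedGrad_apply, hge, mulVec_mulVec, mulVec_mulVec, hE]
    ext j
    rw [mulVec_diagonal]
    by_cases hj : j = i
    · subst hj; simp
    · simp [hj]
  -- The eigenvector is the image of `e`, since a step also creates multiplier components. It is
  -- nonzero because its reduced gradient has `i`-th entry `-(d i)²`.
  refine ⟨S.stepDeriv zs e, fun h => ?_, ?_⟩
  · have h1 := congrFun (hY.reducedGrad_stepDeriv hK hq hD e) i
    rw [h, map_zero, hle] at h1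
    simp [hi] at h1
  · rw [stepDeriv_apply S zs (S.stepDeriv zs e), hY.gradDeriv_stepDeriv hK hq hD, hle, mulVec_smul,
      mulVec_smul, ← hge, ← neg_smul, map_smul, stepDeriv_apply]

end SQPMethod

/-! ### Rates and convergence from the local model -/

namespace SQPMethod

variable {nv ng nh nz : ℕ} {S : SQPMethod nv ng nh} {zs : PrimalDual nv ng nh}
  {Y : Matrix (Fin nv) (Fin nz) ℝ} {d : Fin nz → ℝ}

/-- The step map represents the iteration near the fixed point `zs`, and its derivative there is
described by `Y` and `d`. -/
structure IsLocalModel (S : SQPMethod nv ng nh) (zs : PrimalDual nv ng nh)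
    (Y : Matrix (Fin nv) (Fin nz) ℝ) (d : Fin nz → ℝ) : Prop where
  basis : S.IsDiagonalizingBasis zs Y d
  isUnit_K : IsUnit (S.K zs)
  differentiableAt_q : DifferentiableAt ℝ S.q zs
  C_eq_zero : S.C zs = 0
  D_eq_zero : S.D zs = 0
  isStep_iff : ∀ᶠ z in 𝓝 zs, ∀ z', S.IsStep z z' ↔ z' = S.stepMap zs z
  hasFDerivAt : HasFDerivAt (S.stepMap zs) (S.stepDeriv zs) zs
  stepMap_self : S.stepMap zs zs = zs

theorem IsLocalModel.exists_contraction (h : S.IsLocalModel zs Y d) {κ : ℝ} (hκ : 0 < κ)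
    (hd : ‖d‖ ≤ κ) : ∃ N : Seminorm ℝ (PrimalDual nv ng nh), (∀ x, N x = 0 → x = 0) ∧
      ∀ c', κ < c' → ∀ᶠ z in 𝓝 zs, N (S.stepMap zs z - zs) ≤ c' * N (z - zs) := by
  obtain ⟨C, hC⟩ := h.basis.exists_norm_stepDeriv_le h.isUnit_K h.differentiableAt_q h.D_eq_zero
  obtain ⟨N, hN, hM⟩ := exists_seminorm_map_le (S.stepDeriv zs)
    (reducedGrad S zs Y) d
    (h.basis.reducedGrad_stepDeriv h.isUnit_K h.differentiableAt_q h.D_eq_zero) hC hκ hd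
  exact ⟨N, hN, fun c' hc' => h.hasFDerivAt.eventually_seminorm_le h.stepMap_self N hN hM hc'⟩

theorem IsLocalModel.hasQFactor (h : S.IsLocalModel zs Y d) {κ : ℝ} (hκ : 0 < κ)
    (hd : ‖d‖ ≤ κ) : S.HasQFactor zs κ := by
  obtain ⟨N, hN, hc⟩ := h.exists_contraction hκ hd
  refine ⟨N, hN, fun c' hc' => ?_⟩
  filter_upwards [h.isStep_iff, hc c' hc'] with z h1 h2 z' hz'
  rwa [(h1 z').1 hz']

theorem IsLocalModel.norm_le_of_hasQFactor (h : S.IsLocalModel zs Y d) {c : ℝ} (hc : 0 ≤ c)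
    (hQ : S.HasQFactor zs c) : ‖d‖ ≤ c := by
  obtain ⟨N, hN, hQ⟩ := hQ
  refine (pi_norm_le_iff_of_nonneg hc).2 fun i => ?_
  by_cases hi : d i = 0
  · rwa [hi, norm_zero]
  obtain ⟨x, hx, hMx⟩ := h.basis.exists_eigenvector h.isUnit_K h.differentiableAt_q h.D_eq_zero hi
  have := h.hasFDerivAt.abs_eigenvalue_le h.stepMap_self N hN (c := c) (fun c' hc' => ?_) hx hMx
  · rwa [abs_neg] at this
  · filter_upwards [h.isStep_iff, hQ c' hc'] with z h1 h2
    exact h2 _ ((h1 _).2 rfl)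

theorem IsLocalModel.convergesLocally (h : S.IsLocalModel zs Y d) (hd : ‖d‖ < 1) :
    S.ConvergesLocally zs := by
  have h0 := norm_nonneg d
  -- The norm needs a positive factor at least `‖d‖`, and the nonlinear map a strictly larger one
  -- below `1`: hence the midpoint of `‖d‖` and `1`, then the midpoint of that and `1`.
  obtain ⟨N, hN, hc⟩ := h.exists_contraction (κ := (‖d‖ + 1) / 2) (by linarith) (by linarith)
  exact locallyConverges_of_contraction h.isStep_iff N hN (c := (‖d‖ + 3) / 4) (by linarith)
    (by linarith) (hc _ (by linarith))

theorem IsLocalModel.convergesQLinearly (h : S.IsLocalModel zs Y d) {κ : ℝ} (hd : ‖d‖ ≤ κ)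
    (hκ : κ < 1) : S.ConvergesQLinearly zs κ :=
  ⟨h.convergesLocally (hd.trans_lt hκ), fun _ hc0 hc => h.hasQFactor hc0 (hd.trans hc)⟩

theorem IsLocalModel.abs_le_one_of_convergesLocally (h : S.IsLocalModel zs Y d)
    (hconv : S.ConvergesLocally zs) (i : Fin nz) : |d i| ≤ 1 := by
  by_contra! hi
  have hi0 : d i ≠ 0 := fun h0 => by rw [h0, abs_zero] at hi; linarith
  obtain ⟨x, hx, hMx⟩ := h.basis.exists_eigenvector h.isUnit_K h.differentiableAt_q h.D_eq_zero hi0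
  obtain ⟨C, hC⟩ := h.basis.exists_norm_stepDeriv_le h.isUnit_K h.differentiableAt_q h.D_eq_zero
  exact not_locallyConverges_of_one_lt_abs h.isStep_iff h.hasFDerivAt h.stepMap_self
    (reducedGrad S zs Y) d
    (h.basis.reducedGrad_stepDeriv h.isUnit_K h.differentiableAt_q h.D_eq_zero) hC
    (by rwa [abs_neg]) hx hMx hconv

theorem IsLocalModel.hasAsymptoticRate (h : S.IsLocalModel zs Y d) :
    S.HasAsymptoticRate zs ‖d‖ := by
  refine ⟨?_, h.basis.spectralRadius_iterationMatrix h.isUnit_K h.C_eq_zero h.D_eq_zero,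
    fun c hc => h.norm_le_of_hasQFactor hc.1 hc.2, fun b hb => ?_⟩
  · filter_upwards [h.isStep_iff] with z hz
    exact ⟨S.stepMap zs z, (hz _).2 rfl, fun z' hz' => (hz z').1 hz'⟩
  -- The infimum need not be attained when `d = 0`: the derivative is then nilpotent but possibly
  -- nonzero. Hence the approach through `‖d‖ + ε`.
  · refine le_of_forall_pos_le_add fun ε hε => hb ?_
    have h0 := norm_nonneg d
    exact ⟨by linarith, h.hasQFactor (by linarith) (by linarith)⟩

end SQPMethod

/-! ### The main theorem -/

theorem mainTheorem2 {nv ng nh nz : ℕ} (S : SQPMethod nv ng nh) (zs : PrimalDual nv ng nh)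
    (hW : ContinuousAt S.W zs)
    (hq : DifferentiableAt ℝ S.q zs)
    (hG : ∀ i j, DifferentiableAt ℝ (fun v => S.G v i j) zs.1)
    (hH : ∀ i j, DifferentiableAt ℝ (fun v => S.H v i j) zs.1)
    (hfix : S.IsStep zs zs)
    (hSOSC : S.SOSC zs) (hLICQ : S.LICQ zs) (hSC : S.StrictComplementarity zs)
    (hC : S.C zs = 0) (hD : S.D zs = 0) (hE : (S.E zs).IsSymm)
    (Z : Matrix (Fin nv) (Fin nz) ℝ) (hZ : S.IsNullspaceBasis zs Z) :
    (∃ κ : ℝ,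
      IsLeast {t : ℝ | 0 ≤ t ∧
        LoewnerLE (-(t • reduced Z (S.W zs))) (reduced Z (S.E zs)) ∧
        LoewnerLE (reduced Z (S.E zs)) (t • reduced Z (S.W zs))} κ ∧
      S.HasAsymptoticRate zs κ) ∧
    (∀ κ : ℝ, 0 ≤ κ → κ < 1 →
      LoewnerLE ((1 / (1 + κ)) • reduced Z (S.Lam zs)) (reduced Z (S.W zs)) →
      LoewnerLE (reduced Z (S.W zs)) ((1 / (1 - κ)) • reduced Z (S.Lam zs)) →
      S.ConvergesQLinearly zs κ ∧
      ((∀ t : ℝ, 0 ≤ t → t < κ →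
        ¬ (LoewnerLE ((1 / (1 + t)) • reduced Z (S.Lam zs)) (reduced Z (S.W zs)) ∧
          LoewnerLE (reduced Z (S.W zs)) ((1 / (1 - t)) • reduced Z (S.Lam zs)))) →
        S.HasAsymptoticRate zs κ)) ∧
    (S.ConvergesLocally zs →
      LoewnerLE ((1 / 2 : ℝ) • reduced Z (S.Lam zs)) (reduced Z (S.W zs))) ∧
    ((reduced Z (S.Lam zs)).PosDef →
      LoewnerLT ((1 / 2 : ℝ) • reduced Z (S.Lam zs)) (reduced Z (S.W zs)) →
      ∃ κ : ℝ, 0 ≤ κ ∧ κ < 1 ∧ S.ConvergesQLinearly zs κ) := by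
  have hK := hSOSC.isUnit_K hLICQ
  obtain ⟨T, d, hT, hTW, hTE, hY⟩ := hZ.exists_isDiagonalizingBasis hSOSC hE
  have hmodel : S.IsLocalModel zs (Z * T) d :=
    ⟨hY, hK, hq, hC, hD, SQPMethod.eventually_isStep_iff hW hq hG hH hfix hK hSC hC,
      SQPMethod.hasFDerivAt_stepMap hW hq hG hH hfix hK hC, hfix.stepMap_self⟩
  have hLam : reduced Z (S.Lam zs) = reduced Z (S.E zs) + reduced Z (S.W zs) := by
    simp only [reduced, SQPMethod.E, Matrix.mul_sub, Matrix.sub_mul, sub_add_cancel]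
  have hTW' : Tᵀ * reduced Z (S.W zs) * T = diagonal fun _ => 1 := by
    rw [hTW, diagonal_one]
  have hTL : Tᵀ * reduced Z (S.Lam zs) * T = diagonal fun i => d i + 1 := by
    rw [hLam, Matrix.mul_add, Matrix.add_mul, hTE, hTW', diagonal_add]
  have hsmul : ∀ (a : ℝ) (A : Matrix (Fin nz) (Fin nz) ℝ) (b : Fin nz → ℝ),
      Tᵀ * A * T = diagonal b → Tᵀ * (a • A) * T = diagonal (a • b) := fun a A b h => by
    rw [Matrix.mul_smul, Matrix.smul_mul, h, diagonal_smul]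
  have hlow : ∀ t : ℝ, LoewnerLE (-(t • reduced Z (S.W zs))) (reduced Z (S.E zs)) ↔
      ∀ i, -t ≤ d i := fun t => by
    rw [loewnerLE_congr_iff hT, ← neg_smul, hsmul _ _ _ hTW', hTE, loewnerLE_diagonal_iff]
    simp
  have hupp : ∀ t : ℝ, LoewnerLE (reduced Z (S.E zs)) (t • reduced Z (S.W zs)) ↔
      ∀ i, d i ≤ t := fun t => by
    rw [loewnerLE_congr_iff hT, hsmul _ _ _ hTW', hTE, loewnerLE_diagonal_iff]
    simp
  have hLlow : ∀ a : ℝ, LoewnerLE (a • reduced Z (S.Lam zs)) (reduced Z (S.W zs)) ↔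
      ∀ i, a * (d i + 1) ≤ 1 := fun a => by
    rw [loewnerLE_congr_iff hT, hsmul _ _ _ hTL, hTW', loewnerLE_diagonal_iff]
    simp
  have hLupp : ∀ a : ℝ, LoewnerLE (reduced Z (S.W zs)) (a • reduced Z (S.Lam zs)) ↔
      ∀ i, 1 ≤ a * (d i + 1) := fun a => by
    rw [loewnerLE_congr_iff hT, hsmul _ _ _ hTL, hTW', loewnerLE_diagonal_iff]
    simp
  have hnorm : ∀ t : ℝ, 0 ≤ t → (‖d‖ ≤ t ↔ (∀ i, -t ≤ d i) ∧ ∀ i, d i ≤ t) := fun t ht => by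
    rw [pi_norm_le_iff_of_nonneg ht, ← forall_and]
    exact forall_congr' fun i => by rw [Real.norm_eq_abs, abs_le]
  -- Entrywise, `(d i + 1) / (1 + t) ≤ 1` is `d i ≤ t`, and `1 ≤ (d i + 1) / (1 - t)` is `-t ≤ d i`;
  -- the second uses `t < 1`.
  have hLam_iff : ∀ t : ℝ, 0 ≤ t → t < 1 →
      (‖d‖ ≤ t ↔ LoewnerLE ((1 / (1 + t)) • reduced Z (S.Lam zs)) (reduced Z (S.W zs)) ∧
        LoewnerLE (reduced Z (S.W zs)) ((1 / (1 - t)) • reduced Z (S.Lam zs))) :=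
    fun t ht ht1 => by
    rw [hnorm t ht, hLlow, hLupp, and_comm]
    refine and_congr (forall_congr' fun i => ?_) (forall_congr' fun i => ?_)
    · rw [one_div, inv_mul_le_iff₀ (by linarith)]
      constructor <;> intro h <;> linarith
    · rw [one_div, le_inv_mul_iff₀ (by linarith)]
      constructor <;> intro h <;> linarith
  refine ⟨⟨‖d‖, ⟨⟨norm_nonneg d, ?_⟩, fun t ht => ?_⟩, hmodel.hasAsymptoticRate⟩, ?_, ?_, ?_⟩
  · rw [hlow, hupp]
    exact (hnorm _ (norm_nonneg d)).1 le_rfl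
  · obtain ⟨ht0, ht⟩ := ht
    rw [hlow, hupp] at ht
    exact (hnorm t ht0).2 ht
  · intro κ hκ0 hκ1 h1 h2
    have hd : ‖d‖ ≤ κ := (hLam_iff κ hκ0 hκ1).2 ⟨h1, h2⟩
    refine ⟨hmodel.convergesQLinearly hd hκ1, fun hmin => ?_⟩
    have : ‖d‖ = κ := by
      by_contra hne
      have hlt := lt_of_le_of_ne hd hne
      exact hmin _ (norm_nonneg d) hlt ((hLam_iff _ (norm_nonneg d) (hlt.trans hκ1)).1 le_rfl)
    exact this ▸ hmodel.hasAsymptoticRate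
  · intro hconv
    rw [hLlow]
    intro i
    linarith [(abs_le.1 (hmodel.abs_le_one_of_convergesLocally hconv i)).2]
  · intro hpos hlt
    have hpos' : ∀ i, 0 < d i + 1 := by
      have h := (Matrix.IsUnit.posDef_star_left_conjugate_iff (x := reduced Z (S.Lam zs)) hT).2 hpos
      rw [star_eq_conjTranspose, conjTranspose_eq_transpose_of_trivial, hTL] at h
      exact posDef_diagonal_iff.1 h
    rw [loewnerLT_congr_iff hT, hsmul _ _ _ hTL, hTW', loewnerLT_diagonal_iff] at hlt
    -- `Λ̂_* ≻ 0` supplies `-1 < d i`, and the strict lower bound on `Ŵ_*` supplies `d i < 1`.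
    have hd : ‖d‖ < 1 := by
      refine (pi_norm_lt_iff one_pos).2 fun i => ?_
      have := hlt i
      simp only [Pi.smul_apply, smul_eq_mul] at this
      rw [Real.norm_eq_abs, abs_lt]
      constructor <;> linarith [hpos' i]
    exact ⟨‖d‖, norm_nonneg d, hd, hmodel.convergesQLinearly le_rfl hd⟩
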